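/- Let $\omega=e^{2\pi i/3}$, let $\Gamma=4\pi(i\omega\mathbb Z\oplus i\omega^2\mathbb Z)\subset\mathbb C$, and let $\Gamma^*=\{\mathbf k\in\mathbb C:\ \tfrac12(\gamma\bar{\mathbf k}+\bar\gamma\mathbf k)\in2\pi\mathbb Z\text{ for all }\gamma\in\Gamma\}$ be the dual lattice. Let $U\in C^\infty(\mathbb C/\Gamma;\mathbb C)$ satisfy $$U(z+\mathbf a)=\bar\omega\,U(z)\ \text{ for }\mathbf a=\tfrac43\pi i\omega^\ell,\ \ell=1,2,\qquad U(\omega z)=\omega\,U(z).$$ Write $z=x_1+ix_2$ and $D_{\bar z}=\tfrac1{2i}(\partial_{x_1}+i\partial_{x_2})$ (with domain $H^1$), and for $\alpha,\mathbf k\in\mathbb C$ put $$D(\alpha)=\begin{pmatrix}2D_{\bar z}&\alpha U(z)\\ \alpha U(-z)&2D_{\bar z}\end{pmatrix}\ \text{on }L^2(\mathbb C/\Gamma;\mathbb C^2),\qquad H_{\mathbf k}(\alpha)=\begin{pmatrix}0&D(\alpha)^*-\bar{\mathbf k}\\ D(\alpha)-\mathbf k&0\end{pmatrix}\ \text{on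 }L^2(\mathbb C/\Gamma;\mathbb C^4).$$ Then for every $\mathbf k\notin\Gamma^*$ the operator $2D_{\bar z}-\mathbf k$ on $L^2(\mathbb C/\Gamma;\mathbb C^2)$ has a bounded inverse, and $$T_{\mathbf k}=(2D_{\bar z}-\mathbf k)^{-1}\begin{pmatrix}0&U(z)\\U(-z)&0\end{pmatrix}$$ is a compact operator on $L^2(\mathbb C/\Gamma;\mathbb C^2)$. The spectrum of $T_{\mathbf k}$ is independent of $\mathbf k\notin\Gamma^*$. Moreover, for every $\alpha\in\mathbb C$ and every $\mathbf k\notin\Gamma^*$ the following statements are equivalent: 1. $\alpha\neq0$ and $1/\alpha\in\operatorname{Spec}_{L^2(\mathbb C/\Gamma)}(T_{\mathbf k})$; 2. $\operatorname{Spec}_{L^2(\mathbb C/\Gamma)}D(\alpha)=\mathbb C$; 3. $0\in\bigcap_{\mathbf p\in\mathbb C}\operatorname{Spec}_{L^2(\mathbb C/\Gamma)}(H_{\mathbf p}(\alpha))$. -/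

import Mathlib

open MeasureTheory ComplexConjugate

noncomputable section

namespace TBG

/-! ### Operators with a domain, and their spectrum -/

section Operators

variable {E F G : Type*} [NormedAddCommGroup E] [NormedSpace ℂ E]
  [NormedAddCommGroup F] [NormedSpace ℂ F] [NormedAddCommGroup G] [NormedSpace ℂ G]

/-- The operator of multiplication by the scalar `c`, defined everywhere. -/
def scalarOp (E : Type*) [NormedAddCommGroup E] [NormedSpace ℂ E] (c : ℂ) : E →ₗ.[ℂ] E :=
  (c • (LinearMap.id : E →ₗ[ℂ] E)).toPMap ⊤

/-- The resolvent set of an operator `A` with domain: the `z` for which `A - z` is a bijection of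
the domain of `A` onto the whole space, with a bounded inverse `R`. -/
def resolventSet (A : E →ₗ.[ℂ] E) : Set ℂ :=
  {z | ∃ R : E →L[ℂ] E,
    (∀ f : E, ∃ h : R f ∈ A.domain, A ⟨R f, h⟩ - z • R f = f) ∧
    ∀ u : A.domain, R (A u - z • (u : E)) = u}

/-- The spectrum of an operator with domain. -/
def Spec (A : E →ₗ.[ℂ] E) : Set ℂ := (resolventSet A)ᶜ

/-- The product `B A` of operators with domain, on its natural domain
`{x ∈ dom A : A x ∈ dom B}`. -/
def prodOp (B : F →ₗ.[ℂ] G) (A : E →ₗ.[ℂ] F) : E →ₗ.[ℂ] G where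
  domain :=
    { carrier := {x | ∃ h : x ∈ A.domain, A ⟨x, h⟩ ∈ B.domain}
      add_mem' := by
        rintro x y ⟨hx, hx'⟩ ⟨hy, hy'⟩
        refine ⟨A.domain.add_mem hx hy, ?_⟩
        have := A.map_add ⟨x, hx⟩ ⟨y, hy⟩
        rw [AddMemClass.mk_add_mk] at this
        rw [this]
        exact B.domain.add_mem hx' hy'
      zero_mem' := by
        refine ⟨A.domain.zero_mem, ?_⟩
        have : A ⟨0, A.domain.zero_mem⟩ = 0 := A.map_zero
        rw [this]
        exact B.domain.zero_mem
      smul_mem' := by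
        rintro c x ⟨hx, hx'⟩
        refine ⟨A.domain.smul_mem c hx, ?_⟩
        have := A.map_smul c ⟨x, hx⟩
        rw [SetLike.mk_smul_mk] at this
        rw [this]
        exact B.domain.smul_mem c hx' }
  toFun :=
    { toFun := fun x => B ⟨A ⟨x.1, x.2.choose⟩, x.2.choose_spec⟩
      map_add' := by
        intro x y
        rw [← B.map_add]
        congr 1
        exact Subtype.ext (A.map_add ⟨x.1, x.2.choose⟩ ⟨y.1, y.2.choose⟩)
      map_smul' := by
        intro c x
        rw [RingHom.id_apply, ← B.map_smul]
        congr 1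
        exact Subtype.ext (A.map_smul c ⟨x.1, x.2.choose⟩) }

/-- The operator matrix `[[A, B], [C, D]]` on the Hilbert sum `E ⊕ E`, on its natural domain:
`(u, v) ↦ (A u + B v, C u + D v)` for `u ∈ dom A ∩ dom C` and `v ∈ dom B ∩ dom D`. -/
def blockOp (A B C D : E →ₗ.[ℂ] E) : WithLp 2 (E × E) →ₗ.[ℂ] WithLp 2 (E × E) where
  domain :=
    { carrier := {w | (w.fst ∈ A.domain ∧ w.fst ∈ C.domain) ∧
        (w.snd ∈ B.domain ∧ w.snd ∈ D.domain)}
      add_mem' := by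
        rintro x y ⟨⟨h1, h2⟩, h3, h4⟩ ⟨⟨k1, k2⟩, k3, k4⟩
        exact ⟨⟨A.domain.add_mem h1 k1, C.domain.add_mem h2 k2⟩,
          B.domain.add_mem h3 k3, D.domain.add_mem h4 k4⟩
      zero_mem' := ⟨⟨A.domain.zero_mem, C.domain.zero_mem⟩, B.domain.zero_mem, D.domain.zero_mem⟩
      smul_mem' := by
        rintro c x ⟨⟨h1, h2⟩, h3, h4⟩
        exact ⟨⟨A.domain.smul_mem c h1, C.domain.smul_mem c h2⟩,
          B.domain.smul_mem c h3, D.domain.smul_mem c h4⟩ }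
  toFun :=
    { toFun := fun w => WithLp.toLp 2
        (A ⟨w.1.fst, w.2.1.1⟩ + B ⟨w.1.snd, w.2.2.1⟩, C ⟨w.1.fst, w.2.1.2⟩ + D ⟨w.1.snd, w.2.2.2⟩)
      map_add' := by
        intro x y
        have hA := A.map_add ⟨x.1.fst, x.2.1.1⟩ ⟨y.1.fst, y.2.1.1⟩
        have hB := B.map_add ⟨x.1.snd, x.2.2.1⟩ ⟨y.1.snd, y.2.2.1⟩
        have hC := C.map_add ⟨x.1.fst, x.2.1.2⟩ ⟨y.1.fst, y.2.1.2⟩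
        have hD := D.map_add ⟨x.1.snd, x.2.2.2⟩ ⟨y.1.snd, y.2.2.2⟩
        refine WithLp.ofLp_injective 2 (Prod.ext ?_ ?_)
        · refine Eq.trans ?_ ((congrArg₂ (· + ·) hA hB).trans (add_add_add_comm _ _ _ _))
          rfl
        · refine Eq.trans ?_ ((congrArg₂ (· + ·) hC hD).trans (add_add_add_comm _ _ _ _))
          rfl
      map_smul' := by
        intro c x
        have hA := A.map_smul c ⟨x.1.fst, x.2.1.1⟩
        have hB := B.map_smul c ⟨x.1.snd, x.2.2.1⟩
        have hC := C.map_smul c ⟨x.1.fst, x.2.1.2⟩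
        have hD := D.map_smul c ⟨x.1.snd, x.2.2.2⟩
        refine WithLp.ofLp_injective 2 (Prod.ext ?_ ?_)
        · refine Eq.trans ?_ ((congrArg₂ (· + ·) hA hB).trans (smul_add _ _ _).symm)
          rfl
        · refine Eq.trans ?_ ((congrArg₂ (· + ·) hC hD).trans (smul_add _ _ _).symm)
          rfl }

end Operators

/-! ### The lattice, the dual lattice and the torus -/

/-- `ω = exp (2 π i / 3)`. -/
def ω : ℂ := Complex.exp (2 * Real.pi * Complex.I / 3)

/-- The lattice `Γ = 4 π (i ω ℤ ⊕ i ω² ℤ)`. -/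
def Γ : AddSubgroup ℂ :=
  AddSubgroup.closure {4 * Real.pi * (Complex.I * ω), 4 * Real.pi * (Complex.I * ω ^ 2)}

/-- The dual lattice `Γ*`: the `k` with `(γ k̄ + γ̄ k) / 2 ∈ 2 π ℤ` for all `γ ∈ Γ`. -/
def dualLattice : Set ℂ :=
  {k | ∀ γ ∈ Γ, ∃ n : ℤ, (γ * conj k + conj γ * k) / 2 = 2 * Real.pi * n}

/-- The torus `ℂ / Γ`. -/
abbrev Torus : Type := ℂ ⧸ Γ

/-- A fundamental cell of `Γ`. -/
def cell : Set ℂ :=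
  {z | ∃ s ∈ Set.Ico (0 : ℝ) 1, ∃ t ∈ Set.Ico (0 : ℝ) 1,
    z = s * (4 * Real.pi * (Complex.I * ω)) + t * (4 * Real.pi * (Complex.I * ω ^ 2))}

/-- Lebesgue measure on the torus `ℂ / Γ`. -/
def torusMeasure : Measure Torus :=
  (volume.restrict cell).map (fun z : ℂ => (z : Torus))

/-- `f ∈ C^∞(ℂ / Γ; ℂ)`. -/
def IsSmooth (f : Torus → ℂ) : Prop := ContDiff ℝ (⊤ : ℕ∞) (fun z : ℂ => f (z : Torus))

/-- The classical derivative of a function on the torus in the direction `v`; the directions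
`v = 1` and `v = i` give `∂_{x₁}` and `∂_{x₂}`, where `z = x₁ + i x₂`. -/
def dirDeriv (v : ℂ) (f : Torus → ℂ) (q : Torus) : ℂ :=
  deriv (fun t : ℝ => f (q + (((t : ℂ) * v : ℂ) : Torus))) 0

/-- The space `L²(ℂ / Γ; ℂ)`. -/
abbrev L2 : Type := Lp ℂ 2 torusMeasure

/-- The space `L²(ℂ / Γ; ℂ²) = L²(ℂ / Γ; ℂ) ⊕ L²(ℂ / Γ; ℂ)`. -/
abbrev L2C2 : Type := WithLp 2 (L2 × L2)

/-- The space `L²(ℂ / Γ; ℂ⁴) = L²(ℂ / Γ; ℂ²) ⊕ L²(ℂ / Γ; ℂ²)`. -/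
abbrev L2C4 : Type := WithLp 2 (L2C2 × L2C2)

/-! ### Integrability of the pairing with smooth functions -/

theorem isBounded_cell : Bornology.IsBounded cell := by
  refine (Metric.isBounded_iff_subset_closedBall 0).2
    ⟨‖(4 * Real.pi * (Complex.I * ω) : ℂ)‖ + ‖(4 * Real.pi * (Complex.I * ω ^ 2) : ℂ)‖, ?_⟩
  rintro z ⟨s, hs, t, ht, rfl⟩
  rw [mem_closedBall_zero_iff]
  refine (norm_add_le _ _).trans (add_le_add ?_ ?_)
  · rw [norm_mul, Complex.norm_real, Real.norm_of_nonneg hs.1]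
    exact mul_le_of_le_one_left (norm_nonneg _) hs.2.le
  · rw [norm_mul, Complex.norm_real, Real.norm_of_nonneg ht.1]
    exact mul_le_of_le_one_left (norm_nonneg _) ht.2.le

instance : IsFiniteMeasure torusMeasure := by
  have : IsFiniteMeasure (volume.restrict cell) :=
    isFiniteMeasure_restrict.2 isBounded_cell.measure_lt_top.ne
  unfold torusMeasure
  infer_instance

theorem memLp_of_continuous {g : Torus → ℂ} (hg : Continuous fun z : ℂ => g (z : Torus)) :
    MemLp g 2 torusMeasure := by
  have hm : Measurable g := QuotientAddGroup.measurable_from_quotient.2 hg.measurable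
  obtain ⟨R, hR⟩ := (Metric.isBounded_iff_subset_closedBall 0).1 isBounded_cell
  obtain ⟨C, hC⟩ := (isCompact_closedBall (0 : ℂ) R).exists_bound_of_continuousOn hg.continuousOn
  refine MemLp.of_bound hm.aestronglyMeasurable C ?_
  unfold torusMeasure
  rw [ae_map_iff QuotientAddGroup.measurable_coe.aemeasurable
    (measurableSet_le hm.norm measurable_const)]
  have hle : volume.restrict cell ≤ volume.restrict (Metric.closedBall (0 : ℂ) R) :=
    Measure.restrict_mono hR le_rfl
  exact ae_mono hle (ae_restrict_of_forall_mem Metric.isClosed_closedBall.measurableSet hC)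

theorem IsSmooth.continuous_dirDeriv {φ : Torus → ℂ} (hφ : IsSmooth φ) (v : ℂ) :
    Continuous fun z : ℂ => dirDeriv v φ (z : Torus) := by
  have h1 : ∀ z : ℂ, dirDeriv v φ (z : Torus) = fderiv ℝ (fun z : ℂ => φ (z : Torus)) z v := by
    intro z
    have hd : DifferentiableAt ℝ (fun z : ℂ => φ (z : Torus)) z :=
      (hφ.differentiable (by simp)) z
    have := hd.lineDeriv_eq_fderiv (v := v)
    rw [← this]
    simp only [dirDeriv, lineDeriv, ← QuotientAddGroup.mk_add, Complex.real_smul]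
  simp_rw [h1]
  exact (hφ.continuous_fderiv (by simp)).clm_apply continuous_const

theorem integrable_mul_of_continuous (u : L2) {g : Torus → ℂ}
    (hg : Continuous fun z : ℂ => g (z : Torus)) :
    Integrable (fun q => u q * g q) torusMeasure :=
  (Lp.memLp u).integrable_mul (memLp_of_continuous hg)

/-! ### The operators -/

/-- `w` is the weak derivative of `u` in the direction `v`:
`∫ u ∂_v φ = - ∫ w φ` for all smooth `φ` on the torus. -/
def IsWeakDeriv (v : ℂ) (u w : L2) : Prop :=
  ∀ φ : Torus → ℂ, IsSmooth φ →
    ∫ q, u q * dirDeriv v φ q ∂torusMeasure = - ∫ q, w q * φ q ∂torusMeasure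

/-- The pairs `(u, w)` in `L² × L²` such that `w` is the weak derivative of `u` in the
direction `v`. -/
def weakDerivGraph (v : ℂ) : Submodule ℂ (L2 × L2) where
  carrier := {p | IsWeakDeriv v p.1 p.2}
  add_mem' := by
    rintro p p' h h' φ hφ
    have c1 := hφ.continuous_dirDeriv v
    have c2 : Continuous fun z : ℂ => φ (z : Torus) := hφ.continuous
    have e1 : ∀ (u u' : L2) (g : Torus → ℂ), (Continuous fun z : ℂ => g (z : Torus)) →
        ∫ q, (u + u' : L2) q * g q ∂torusMeasure =
          ∫ q, u q * g q ∂torusMeasure + ∫ q, u' q * g q ∂torusMeasure := by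
      intro u u' g hg
      rw [← integral_add (integrable_mul_of_continuous u hg) (integrable_mul_of_continuous u' hg)]
      refine integral_congr_ae ?_
      filter_upwards [Lp.coeFn_add u u'] with q hq
      rw [hq, Pi.add_apply, add_mul]
    rw [Prod.fst_add, Prod.snd_add, e1 _ _ _ c1, e1 _ _ _ c2, h φ hφ, h' φ hφ, neg_add]
  zero_mem' := by
    intro φ hφ
    have e1 : ∀ g : Torus → ℂ, ∫ q, (0 : L2) q * g q ∂torusMeasure = 0 := by
      intro g
      refine integral_eq_zero_of_ae ?_
      filter_upwards [Lp.coeFn_zero ℂ 2 torusMeasure] with q hq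
      rw [hq, Pi.zero_apply, zero_mul]
    rw [Prod.fst_zero, Prod.snd_zero, e1, e1, neg_zero]
  smul_mem' := by
    rintro c p h φ hφ
    have e1 : ∀ (u : L2) (g : Torus → ℂ),
        ∫ q, (c • u : L2) q * g q ∂torusMeasure = c * ∫ q, u q * g q ∂torusMeasure := by
      intro u g
      rw [← integral_const_mul]
      refine integral_congr_ae ?_
      filter_upwards [Lp.coeFn_smul c u] with q hq
      rw [hq, Pi.smul_apply, smul_eq_mul, mul_assoc]
    rw [Prod.smul_fst, Prod.smul_snd, e1, e1, h φ hφ, mul_neg]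

/-- The derivative in the direction `v` on `L²(ℂ / Γ)`: its domain consists of the `u ∈ L²` with a
weak derivative in `L²`. -/
def weakDeriv (v : ℂ) : L2 →ₗ.[ℂ] L2 := (weakDerivGraph v).toLinearPMap

/-- `D_{z̄} = (1 / 2i) (∂_{x₁} + i ∂_{x₂})` on `L²(ℂ / Γ)`, with domain `H¹(ℂ / Γ)`, the `u` whose
two weak partial derivatives are in `L²`. -/
def Dbar : L2 →ₗ.[ℂ] L2 :=
  (1 / (2 * Complex.I)) • (weakDeriv 1 + Complex.I • weakDeriv Complex.I)

/-- Multiplication by the function `f` on `L²(ℂ / Γ)`, with domain `{u ∈ L² : f u ∈ L²}`. -/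
def mulOp (f : Torus → ℂ) : L2 →ₗ.[ℂ] L2 where
  domain :=
    { carrier := {u | MemLp (fun q => f q * u q) 2 torusMeasure}
      add_mem' := by
        intro u u' h h'
        refine (memLp_congr_ae ?_).1 (h.add h')
        filter_upwards [Lp.coeFn_add u u'] with q hq
        rw [hq, Pi.add_apply, Pi.add_apply, mul_add]
      zero_mem' := by
        refine (memLp_congr_ae ?_).1 (MemLp.zero (ε := ℂ))
        filter_upwards [Lp.coeFn_zero ℂ 2 torusMeasure] with q hq
        rw [hq, Pi.zero_apply, mul_zero]
      smul_mem' := by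
        intro c u h
        refine (memLp_congr_ae ?_).1 (h.const_smul c)
        filter_upwards [Lp.coeFn_smul c u] with q hq
        rw [hq, Pi.smul_apply, Pi.smul_apply, smul_eq_mul, smul_eq_mul, mul_left_comm] }
  toFun :=
    { toFun := fun u => MemLp.toLp (fun q => f q * u.1 q) u.2
      map_add' := by
        intro u u'
        rw [← MemLp.toLp_add]
        refine MemLp.toLp_congr _ _ ?_
        filter_upwards [Lp.coeFn_add u.1 u'.1] with q hq
        rw [Submodule.coe_add, hq, Pi.add_apply, Pi.add_apply, mul_add]
      map_smul' := by
        intro c u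
        rw [RingHom.id_apply, ← MemLp.toLp_const_smul]
        refine MemLp.toLp_congr _ _ ?_
        filter_upwards [Lp.coeFn_smul c u.1] with q hq
        rw [Submodule.coe_smul, hq, Pi.smul_apply, Pi.smul_apply, smul_eq_mul, smul_eq_mul,
          mul_left_comm] }

/-- The admissible potentials: `U ∈ C^∞(ℂ / Γ; ℂ)` with `U(z + a) = ω̄ U(z)` for
`a = (4/3) π i ω^ℓ`, `ℓ = 1, 2`, and `U(ω z) = ω U(z)`. -/
structure IsPotential (U : Torus → ℂ) : Prop where
  smooth : IsSmooth U
  translation : ∀ ℓ : ℕ, ℓ = 1 ∨ ℓ = 2 → ∀ z : ℂ,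
    U ((z + 4 / 3 * Real.pi * Complex.I * ω ^ ℓ : ℂ) : Torus) = conj ω * U (z : Torus)
  rotation : ∀ z : ℂ, U ((ω * z : ℂ) : Torus) = ω * U (z : Torus)

/-- `D(α) = [[2 D_{z̄}, α U(z)], [α U(-z), 2 D_{z̄}]]` on `L²(ℂ / Γ; ℂ²)`. -/
def D (U : Torus → ℂ) (α : ℂ) : L2C2 →ₗ.[ℂ] L2C2 :=
  blockOp ((2 : ℂ) • Dbar) (mulOp fun q => α * U q)
    (mulOp fun q => α * U (-q)) ((2 : ℂ) • Dbar)

/-- `H_k(α) = [[0, D(α)* - k̄], [D(α) - k, 0]]` on `L²(ℂ / Γ; ℂ⁴)`. -/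
def H (U : Torus → ℂ) (k α : ℂ) : L2C4 →ₗ.[ℂ] L2C4 :=
  blockOp 0 ((D U α).adjoint - scalarOp L2C2 (conj k))
    (D U α - scalarOp L2C2 k) 0

/-- `2 D_{z̄}` acting componentwise on `L²(ℂ / Γ; ℂ²)`. -/
def twoDbar : L2C2 →ₗ.[ℂ] L2C2 := blockOp ((2 : ℂ) • Dbar) 0 0 ((2 : ℂ) • Dbar)

/-- `T_k = (2 D_{z̄} - k)⁻¹ [[0, U(z)], [U(-z), 0]]` on `L²(ℂ / Γ; ℂ²)`. -/
def T (U : Torus → ℂ) (k : ℂ) : L2C2 →ₗ.[ℂ] L2C2 :=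
  prodOp (twoDbar - scalarOp L2C2 k).inverse
    (blockOp 0 (mulOp U) (mulOp fun q => U (-q)) 0)

end TBG

end

noncomputable section

namespace TBG

/-! ### The lattice and its dual -/

/-! Off Γ* the problem is of Fredholm type. There `2 D_{z̄} - k` has a compact inverse, the Fourier
multiplier 1 / (p - k), so k lies in Spec D(α) exactly when α T_k has the eigenvalue -1
(`IsResolvent.mem_Spec_add_iff`). Conjugation by diag(1, -1) changes the sign of T_k, and the
condition becomes 1/α ∈ Spec T_k (`mem_Spec_D_iff`). What carries the theorem is a dichotomy: if
Spec D(α) has one point off Γ*, it is all of ℂ (`Spec_D_eq_univ`).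

Let (X, Y) be an eigenfunction at k ∉ Γ*; it is smooth. It has a common zero
(`IsEigenSeq.exists_zero`). Indeed, by the rotation symmetry of U, the Wronskian X(z) Y(ωz) - Y(z)
X(ωz) solves 2 D_{z̄} W = -ωk W. By Liouville a periodic solution is a multiple of a plane wave, and
it vanishes because -ωk ∉ Γ*. Without a common zero, the rotated pair would then be f (X, Y) with f
periodic and 2 D_{z̄} f = (ω̄ - 1) k f, hence again a multiple of a plane wave. But f = 1 at every
point that the rotation fixes modulo Γ; the points 0 and γ / (ω - 1) force k ∈ Γ*.

At a common zero z, multiply by the Green function G of 2 D_{z̄} - k' with pole at z. The zero kills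
the delta function, so (G X, G Y) is an eigenfunction at k + k' (`green_eq`). It is nonzero for
small k' ≠ 0, because one term of the convolution of Fourier coefficients is of size 1/|k'| and the
others stay bounded (`exists_conv_greenCoeff_ne_zero`). So Spec D(α) is open and closed in ℂ \ Γ*,
which is connected and dense since Γ* is countable.

The nonzero part of Spec T_k is therefore independent of k; for the point 0, resolvents at two
points differ by an invertible factor. Finally H_p(α) is invertible exactly when D(α) - p is, the
inverse being built from the resolvent and its adjoint (`zero_mem_resolventSet_block_iff`). -/

theorem ω_eq : ω = ⟨-1 / 2, √3 / 2⟩ := by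
  have h : (2 * Real.pi * Complex.I / 3 : ℂ) = ((Real.pi - Real.pi / 3 : ℝ) : ℂ) * Complex.I := by
    push_cast; ring
  rw [ω, h, Complex.exp_mul_I, ← Complex.ofReal_cos, ← Complex.ofReal_sin, Real.cos_pi_sub,
    Real.sin_pi_sub, Real.cos_pi_div_three, Real.sin_pi_div_three]
  apply Complex.ext <;> simp
  norm_num

theorem sqrt_three_mul_self : √3 * √3 = 3 := Real.mul_self_sqrt (by norm_num)

theorem ω_ne_one : ω ≠ 1 := by
  rw [ω_eq]
  intro h
  have := congrArg Complex.re h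
  norm_num at this

theorem ω_sq : ω ^ 2 = -1 - ω := by
  have := sqrt_three_mul_self
  rw [ω_eq]
  apply Complex.ext <;> simp [pow_two] <;> nlinarith

theorem conj_ω : conj ω = ω ^ 2 := by
  have := sqrt_three_mul_self
  rw [ω_eq]
  apply Complex.ext <;> simp [pow_two] <;> nlinarith

/-! ### The real pairing and the dual bases of Γ and Γ* -/

/-- The real pairing `Re (p̄ z)`. -/
def pair (p z : ℂ) : ℝ := p.re * z.re + p.im * z.im

theorem pair_add_left (p q z : ℂ) : pair (p + q) z = pair p z + pair q z := by
  simp only [pair, Complex.add_re, Complex.add_im]; ring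

theorem pair_add_right (p z w : ℂ) : pair p (z + w) = pair p z + pair p w := by
  simp only [pair, Complex.add_re, Complex.add_im]; ring

theorem pair_neg_left (p z : ℂ) : pair (-p) z = -pair p z := by
  simp only [pair, Complex.neg_re, Complex.neg_im]; ring

theorem pair_zero_left (z : ℂ) : pair 0 z = 0 := by simp [pair]

theorem pair_zero_right (p : ℂ) : pair p 0 = 0 := by simp [pair]

theorem pair_real_mul_right (p z : ℂ) (t : ℝ) : pair p (t * z) = t * pair p z := by
  simp [pair]; ring

theorem pair_real_mul_left (p z : ℂ) (t : ℝ) : pair (t * p) z = t * pair p z := by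
  simp [pair]; ring

theorem pair_mul_left (c p z : ℂ) : pair (c * p) z = pair p (conj c * z) := by
  simp [pair]; ring

theorem abs_pair_le (p z : ℂ) : |pair p z| ≤ ‖p‖ * ‖z‖ := by
  have h : pair p z = (conj p * z).re := by simp [pair]
  rw [h]
  refine (Complex.abs_re_le_norm _).trans ?_
  simp

/-- The generators of `Γ`. -/
def gen : Fin 2 → ℂ := ![4 * Real.pi * (Complex.I * ω), 4 * Real.pi * (Complex.I * ω ^ 2)]

/-- The generators of `Γ*`, dual to `gen`. -/
def dualGen : Fin 2 → ℂ := ![⟨-√3 / 6, -1 / 2⟩, ⟨√3 / 6, -1 / 2⟩]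

theorem gen_zero : gen 0 = ⟨-(2 * Real.pi * √3), -(2 * Real.pi)⟩ := by
  simp only [gen, Matrix.cons_val_zero]
  rw [ω_eq]
  apply Complex.ext <;> simp <;> ring

theorem gen_one : gen 1 = ⟨2 * Real.pi * √3, -(2 * Real.pi)⟩ := by
  simp only [gen, Matrix.cons_val_one, Matrix.cons_val_zero]
  rw [ω_sq, ω_eq]
  apply Complex.ext <;> simp <;> ring

theorem pair_dualGen_gen (i j : Fin 2) : pair (dualGen i) (gen j) = if i =
    j then 2 * Real.pi else 0 := by
  have := sqrt_three_mul_self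
  fin_cases i <;> fin_cases j <;> simp [gen_zero, gen_one, pair, dualGen] <;>
    linarith [congrArg (Real.pi * ·) this]

theorem linearIndependent_gen : LinearIndependent ℝ gen := by
  have h : gen = ![gen 0, gen 1] := by ext i; fin_cases i <;> rfl
  rw [h, LinearIndependent.pair_iff]
  intro s t hst
  have h0 := congrArg (pair (dualGen 0)) hst
  have h1 := congrArg (pair (dualGen 1)) hst
  simp only [Complex.real_smul, pair_add_right, pair_real_mul_right, pair_dualGen_gen,
    pair_zero_right] at h0 h1
  have := Real.pi_pos
  constructor
  · simpa [this.ne'] using h0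
  · simpa [this.ne'] using h1

theorem linearIndependent_dualGen : LinearIndependent ℝ dualGen := by
  have h : dualGen = ![dualGen 0, dualGen 1] := by ext i; fin_cases i <;> rfl
  rw [h, LinearIndependent.pair_iff]
  intro s t hst
  have h0 := congrArg (fun p => pair p (gen 0)) hst
  have h1 := congrArg (fun p => pair p (gen 1)) hst
  simp only [Complex.real_smul, pair_add_left, pair_real_mul_left, pair_dualGen_gen,
    pair_zero_left] at h0 h1
  have := Real.pi_pos
  constructor
  · simpa [this.ne'] using h0
  · simpa [this.ne'] using h1

/-- `gen` as a real basis of `ℂ`. -/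
def genBasis : Module.Basis (Fin 2) ℝ ℂ :=
  basisOfLinearIndependentOfCardEqFinrank linearIndependent_gen (by simp)

/-- `dualGen` as a real basis of `ℂ`. -/
def dualGenBasis : Module.Basis (Fin 2) ℝ ℂ :=
  basisOfLinearIndependentOfCardEqFinrank linearIndependent_dualGen (by simp)

theorem coe_genBasis : ⇑genBasis = gen := by simp [genBasis]

theorem coe_dualGenBasis : ⇑dualGenBasis = dualGen := by simp [dualGenBasis]

theorem range_gen : Set.range gen =
    {4 * Real.pi * (Complex.I * ω), 4 * Real.pi * (Complex.I * ω ^ 2)} := by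
  simp [gen, Matrix.range_cons, Matrix.range_empty, Set.pair_comm]

theorem Γ_eq : Γ = (Submodule.span ℤ (Set.range genBasis)).toAddSubgroup := by
  rw [coe_genBasis, range_gen, Γ, Submodule.span_int_eq_addSubgroupClosure]

theorem gen_mem (i : Fin 2) : gen i ∈ Γ := by
  rw [Γ, ← range_gen]
  exact AddSubgroup.subset_closure ⟨i, rfl⟩

/-- Coordinates with respect to `gen` are read off by pairing with `dualGen`, the two families being
dual up to the factor 2π. -/
theorem sum_gen (z : ℂ) :
    z = ((pair (dualGen 0) z / (2 * Real.pi) : ℝ) : ℂ) * gen 0 +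
      ((pair (dualGen 1) z / (2 * Real.pi) : ℝ) : ℂ) * gen 1 := by
  have := sqrt_three_mul_self
  rw [gen_zero, gen_one]
  apply Complex.ext <;>
    simp only [Complex.add_re, Complex.add_im, Complex.re_ofReal_mul, Complex.im_ofReal_mul, pair,
      dualGen, Matrix.cons_val_zero, Matrix.cons_val_one] <;> field_simp
  · linear_combination (-4 * z.re) * this
  · ring

theorem sum_dualGen (p : ℂ) :
    p = ((pair p (gen 0) / (2 * Real.pi) : ℝ) : ℂ) * dualGen 0 +
      ((pair p (gen 1) / (2 * Real.pi) : ℝ) : ℂ) * dualGen 1 := by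
  have := sqrt_three_mul_self
  rw [gen_zero, gen_one]
  apply Complex.ext <;>
    simp only [Complex.add_re, Complex.add_im, Complex.re_ofReal_mul, Complex.im_ofReal_mul, pair,
      dualGen, Matrix.cons_val_zero, Matrix.cons_val_one] <;> field_simp
  · linear_combination (-2 * p.re) * this
  · ring

theorem genBasis_repr (z : ℂ) (i : Fin 2) :
    genBasis.repr z i = pair (dualGen i) z / (2 * Real.pi) := by
  have h : z = ∑ i, (pair (dualGen i) z / (2 * Real.pi)) • genBasis i := by
    rw [coe_genBasis, Fin.sum_univ_two, Complex.real_smul, Complex.real_smul]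
    exact sum_gen z
  conv_lhs => rw [h]
  rw [genBasis.repr_sum_self]

theorem cell_eq : cell = ZSpan.fundamentalDomain genBasis := by
  ext z
  rw [ZSpan.mem_fundamentalDomain]
  constructor
  · rintro ⟨s, hs, t, ht, rfl⟩ i
    have h : ∀ j, genBasis.repr (s * (4 * Real.pi * (Complex.I * ω)) +
        t * (4 * Real.pi * (Complex.I * ω ^ 2))) j = ![s, t] j := by
      intro j
      have h0 : (4 * Real.pi * (Complex.I * ω)) = gen 0 := rfl
      have h1 : (4 * Real.pi * (Complex.I * ω ^ 2)) = gen 1 := rfl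
      rw [h0, h1, genBasis_repr, pair_add_right, pair_real_mul_right, pair_real_mul_right,
        pair_dualGen_gen, pair_dualGen_gen]
      fin_cases j <;> simp
    rw [h]
    fin_cases i
    · exact hs
    · exact ht
  · intro h
    refine ⟨_, h 0, _, h 1, ?_⟩
    rw [genBasis_repr, genBasis_repr]
    exact sum_gen z

theorem mem_Γ_iff (z : ℂ) :
    z ∈ Γ ↔ ∃ m n : ℤ, z = (m : ℂ) * gen 0 + (n : ℂ) * gen 1 := by
  rw [Γ_eq, coe_genBasis]
  have : Set.range gen = {gen 0, gen 1} := range_gen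
  rw [Submodule.mem_toAddSubgroup, this, Submodule.mem_span_pair]
  simp [zsmul_eq_mul, eq_comm]

/-- The dual lattice, as a `ℤ`-submodule of `ℂ`. -/
abbrev dualModule : Submodule ℤ ℂ := Submodule.span ℤ (Set.range dualGenBasis)

theorem mem_dualModule_iff (p : ℂ) :
    p ∈ dualModule ↔ ∃ m n : ℤ, p = (m : ℂ) * dualGen 0 + (n : ℂ) * dualGen 1 := by
  have : Set.range dualGen = {dualGen 0, dualGen 1} := by
    ext x; simp [Fin.exists_fin_two, eq_comm]
  rw [dualModule, coe_dualGenBasis, this, Submodule.mem_span_pair]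
  simp [zsmul_eq_mul, eq_comm]

theorem mem_dualLattice_iff (k : ℂ) :
    k ∈ dualLattice ↔ ∀ γ ∈ Γ, ∃ n : ℤ, pair k γ = 2 * Real.pi * n := by
  refine forall₂_congr fun γ _ => exists_congr fun n => ?_
  have h : (γ * conj k + conj γ * k) / 2 = (pair k γ : ℂ) := by
    apply Complex.ext <;> simp [pair] <;> ring
  rw [h]
  norm_cast

theorem mem_dualLattice_iff_mem_dualModule (k : ℂ) : k ∈ dualLattice ↔ k ∈ dualModule := by
  rw [mem_dualLattice_iff, mem_dualModule_iff]
  have hpi := Real.pi_pos.ne'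
  constructor
  · intro h
    obtain ⟨m, hm⟩ := h _ (gen_mem 0)
    obtain ⟨n, hn⟩ := h _ (gen_mem 1)
    refine ⟨m, n, ?_⟩
    conv_lhs => rw [sum_dualGen k]
    rw [hm, hn, mul_div_cancel_left₀ _ (by positivity), mul_div_cancel_left₀ _ (by positivity)]
    simp
  · rintro ⟨m, n, rfl⟩ γ hγ
    obtain ⟨a, b, rfl⟩ := (mem_Γ_iff γ).1 hγ
    refine ⟨m * a + n * b, ?_⟩
    have e : ∀ j : ℤ, (j : ℂ) = ((j : ℝ) : ℂ) := fun j => by simp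
    rw [e m, e n, e a, e b]
    simp only [pair_add_left, pair_add_right, pair_real_mul_left, pair_real_mul_right,
      pair_dualGen_gen]
    push_cast
    simp
    ring

theorem exists_pair_eq (p : dualModule) {γ : ℂ} (hγ : γ ∈ Γ) :
    ∃ n : ℤ, pair p γ = 2 * Real.pi * n :=
  (mem_dualLattice_iff p).1 ((mem_dualLattice_iff_mem_dualModule p).2 p.2) γ hγ

theorem ω_mul_mem_Γ {γ : ℂ} (hγ : γ ∈ Γ) : ω * γ ∈ Γ := by
  obtain ⟨m, n, rfl⟩ := (mem_Γ_iff γ).1 hγ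
  refine (mem_Γ_iff _).2 ⟨-n, m - n, ?_⟩
  have h0 : ω * gen 0 = gen 1 := by simp [gen]; ring
  have h1 : ω * gen 1 = -gen 0 - gen 1 := by
    simp only [gen, Matrix.cons_val_zero, Matrix.cons_val_one]
    linear_combination (4 * Real.pi * Complex.I * ω) * ω_sq
  push_cast
  linear_combination (m : ℂ) * h0 + n * h1

/-- The adjoint of multiplication by ω for the pairing is multiplication by ω̄ = ω², under which Γ
is stable. -/
theorem ω_mul_mem_dualLattice {k : ℂ} (hk : k ∈ dualLattice) : ω * k ∈ dualLattice := by
  rw [mem_dualLattice_iff] at hk ⊢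
  intro γ hγ
  rw [pair_mul_left, conj_ω, pow_two, mul_assoc]
  exact hk _ (ω_mul_mem_Γ (ω_mul_mem_Γ hγ))

/-! ### The dual lattice is discrete -/

theorem finrank_dualModule : Module.finrank ℤ dualModule = 2 := by
  rw [ZLattice.rank ℝ]
  exact Complex.finrank_real_complex

theorem countable_dualLattice : dualLattice.Countable := by
  have h : dualLattice = (dualModule : Set ℂ) := by
    ext k; exact mem_dualLattice_iff_mem_dualModule k
  rw [h]
  exact (inferInstance : Countable dualModule)

theorem isClosed_dualLattice : IsClosed dualLattice := by
  have h : dualLattice = (dualModule.toAddSubgroup : Set ℂ) := by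
    ext k; exact mem_dualLattice_iff_mem_dualModule k
  rw [h]
  exact AddSubgroup.isClosed_of_discrete

theorem exists_dist_dualModule_le {k : ℂ} (hk : k ∉ dualLattice) :
    ∃ δ > 0, ∀ p : dualModule, δ ≤ ‖(p : ℂ) - k‖ := by
  obtain ⟨δ, hδ, h⟩ := Metric.isOpen_iff.1 isClosed_dualLattice.isOpen_compl k hk
  refine ⟨δ, hδ, fun p => ?_⟩
  by_contra hp
  rw [not_le, ← dist_eq_norm] at hp
  exact h hp ((mem_dualLattice_iff_mem_dualModule p).2 p.2)

theorem exists_norm_dualModule_le : ∃ ρ > 0, ∀ p : dualModule, p ≠ 0 → ρ ≤ ‖(p : ℂ)‖ := by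
  have h := discreteTopology_iff_isOpen_singleton_zero.1 (inferInstance : DiscreteTopology
      dualModule)
  obtain ⟨ρ, hρ, h⟩ := Metric.isOpen_iff.1 h 0 rfl
  refine ⟨ρ, hρ, fun p hp => ?_⟩
  by_contra hlt
  exact hp (h (by rw [mem_ball_zero_iff]; exact not_le.1 hlt))

theorem finite_norm_dualModule_le (R : ℝ) : {p : dualModule | ‖(p : ℂ)‖ ≤ R}.Finite := by
  have h := ZSpan.setFinite_inter dualGenBasis (Metric.isBounded_closedBall (x := (0 : ℂ)) (r := R))
  refine Set.Finite.of_finite_image (f := fun p : dualModule => (p : ℂ)) (h.subset ?_)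
    Subtype.coe_injective.injOn
  rintro _ ⟨p, hp, rfl⟩
  exact ⟨by simpa using hp, p.2⟩

/-- The exponent 3 exceeds the rank 2 of the lattice; the shift by 1 makes p = 0 harmless. -/
theorem summable_one_add_norm_inv :
    Summable fun p : dualModule => ((1 + ‖(p : ℂ)‖) ^ 3)⁻¹ := by
  have h := ZLattice.summable_norm_pow_inv dualModule 3 (by rw [finrank_dualModule]; norm_num)
  refine Summable.of_norm_bounded_eventually (g := fun p : dualModule => (‖p‖ ^ 3)⁻¹)
    (by simpa using h) ?_
  filter_upwards [(Set.finite_singleton (0 : dualModule)).compl_mem_cofinite] with p hp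
  have hp' : 0 < ‖p‖ := norm_pos_iff.2 hp
  rw [Real.norm_of_nonneg (by positivity)]
  change ((1 + ‖p‖) ^ 3)⁻¹ ≤ _
  gcongr
  linarith

/-! ### The torus -/

instance : DiscreteTopology Γ := by
  rw [Γ_eq]; infer_instance

instance isClosed_Γ : IsClosed (Γ : Set ℂ) := AddSubgroup.isClosed_of_discrete

instance : T2Space Torus := inferInstance
instance : BorelSpace Torus := inferInstance
instance : SecondCountableTopology Torus := inferInstance

theorem isAddFundamentalDomain_cell : IsAddFundamentalDomain Γ cell (volume : Measure ℂ) := by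
  rw [cell_eq]
  have := ZSpan.isAddFundamentalDomain' genBasis (volume : Measure ℂ)
  rw [← Γ_eq] at this
  exact this

theorem coe_surjOn_cell : Set.SurjOn (fun z : ℂ => (z : Torus)) cell Set.univ := by
  rintro q -
  obtain ⟨z, rfl⟩ := QuotientAddGroup.mk_surjective q
  refine ⟨ZSpan.fract genBasis z, by rw [cell_eq]; exact ZSpan.fract_mem_fundamentalDomain _ _, ?_⟩
  refine (QuotientAddGroup.eq.2 ?_)
  rw [ZSpan.fract_apply, neg_sub, sub_add_cancel, Γ_eq]
  exact (ZSpan.floor genBasis z).2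

instance : CompactSpace Torus := by
  refine ⟨?_⟩
  have h : Set.univ = (fun z : ℂ => (z : Torus)) '' closure cell := by
    refine (Set.eq_univ_of_univ_subset ?_).symm
    exact coe_surjOn_cell.trans (Set.image_mono subset_closure)
  rw [h]
  exact (isBounded_cell.isCompact_closure).image QuotientAddGroup.continuous_mk

-- Quotient measures are set up for the right action of the subgroup; as ℂ is commutative, the
-- translates are those of the left action.
open Pointwise in
theorem isAddFundamentalDomain_op_cell :
    IsAddFundamentalDomain Γ.op cell (volume : Measure ℂ) := by
  have h := isAddFundamentalDomain_cell
  refine ⟨h.nullMeasurableSet, ?_, ?_⟩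
  · filter_upwards [h.ae_covers] with x ⟨g, hg⟩
    refine ⟨⟨AddOpposite.op g, g.2⟩, ?_⟩
    convert! hg using 1
    exact add_comm _ _
  · intro g g' hg
    have e : ∀ g : Γ.op, g +ᵥ cell = (⟨AddOpposite.unop g, g.2⟩ : Γ) +ᵥ cell := by
      intro g
      ext x
      simp only [Set.mem_vadd_set]
      refine exists_congr fun y => and_congr_right fun _ => ?_
      exact Eq.congr_left (add_comm _ _)
    have hh := h.aedisjoint (i := ⟨AddOpposite.unop g, g.2⟩) (j := ⟨AddOpposite.unop g', g'.2⟩) (by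
      intro e
      apply hg
      have := congrArg (fun x : Γ => (x : ℂ)) e
      exact Subtype.ext (AddOpposite.unop_injective this))
    simp only [Function.onFun] at hh ⊢
    rwa [e, e]

instance : Countable Γ := by
  rw [Γ_eq]
  exact (inferInstance : Countable (Submodule.span ℤ (Set.range genBasis)))

instance : Countable Γ.op := Γ.equivOp.symm.injective.countable

instance : AddQuotientMeasureEqMeasurePreimage (volume : Measure ℂ) torusMeasure :=
  isAddFundamentalDomain_op_cell.addQuotientMeasureEqMeasurePreimage_addQuotientMeasure

instance : HasAddFundamentalDomain Γ.op ℂ (volume : Measure ℂ) :=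
  ⟨⟨cell, isAddFundamentalDomain_op_cell⟩⟩

/-- Translation invariance is what makes characters orthogonal and integrals of derivatives vanish.
-/
instance : torusMeasure.IsAddHaarMeasure :=
  AddQuotientMeasureEqMeasurePreimage.addHaarMeasure_quotient (volume : Measure ℂ)

/-! ### Characters -/

/-- The plane wave `z ↦ exp (i Re (p̄ z))`. -/
def wave (p z : ℂ) : ℂ := Complex.exp (pair p z * Complex.I)

theorem wave_add_left (p q z : ℂ) : wave (p + q) z = wave p z * wave q z := by
  rw [wave, wave, wave, ← Complex.exp_add, pair_add_left]
  push_cast; ring_nf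

theorem wave_add_right (p z w : ℂ) : wave p (z + w) = wave p z * wave p w := by
  rw [wave, wave, wave, ← Complex.exp_add, pair_add_right]
  push_cast; ring_nf

theorem wave_zero_left (z : ℂ) : wave 0 z = 1 := by simp [wave, pair_zero_left]

theorem wave_zero_right (p : ℂ) : wave p 0 = 1 := by simp [wave, pair_zero_right]

theorem norm_wave (p z : ℂ) : ‖wave p z‖ = 1 := Complex.norm_exp_ofReal_mul_I _

theorem conj_wave (p z : ℂ) : conj (wave p z) = wave (-p) z := by
  rw [wave, wave, ← Complex.exp_conj, pair_neg_left]
  simp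

theorem wave_eq_one_iff (p z : ℂ) : wave p z = 1 ↔ ∃ n : ℤ, pair p z = 2 * Real.pi * n := by
  rw [wave, Complex.exp_eq_one_iff]
  refine exists_congr fun n => ?_
  rw [← mul_assoc, mul_left_inj' Complex.I_ne_zero, mul_comm (n : ℂ)]
  norm_cast

theorem mem_dualLattice_iff_wave (k : ℂ) : k ∈ dualLattice ↔ ∀ γ ∈ Γ, wave k γ = 1 := by
  simp_rw [mem_dualLattice_iff, wave_eq_one_iff]

theorem wave_gamma (p : dualModule) {γ : ℂ} (hγ : γ ∈ Γ) : wave p γ = 1 :=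
  (wave_eq_one_iff _ _).2 (exists_pair_eq p hγ)

theorem contDiff_wave (p : ℂ) : ContDiff ℝ (⊤ : ℕ∞) (wave p) := by
  unfold wave pair
  have h1 : ContDiff ℝ (⊤ : ℕ∞) (fun z : ℂ => z.re) := Complex.reCLM.contDiff
  have h2 : ContDiff ℝ (⊤ : ℕ∞) (fun z : ℂ => z.im) := Complex.imCLM.contDiff
  have h3 : ContDiff ℝ (⊤ : ℕ∞) (fun z : ℂ => (p.re * z.re + p.im * z.im : ℝ)) :=
    (contDiff_const.mul h1).add (contDiff_const.mul h2)
  have h4 : ContDiff ℝ (⊤ : ℕ∞) (fun z : ℂ => ((p.re * z.re + p.im * z.im : ℝ) : ℂ)) :=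
    Complex.ofRealCLM.contDiff.comp h3
  exact (h4.mul contDiff_const).cexp

theorem hasFDerivAt_wave (p z : ℂ) :
    HasFDerivAt (wave p) ((Complex.I * wave p z) •
      (Complex.ofRealCLM.comp (p.re • Complex.reCLM + p.im • Complex.imCLM))) z := by
  have h1 : HasFDerivAt (fun z : ℂ => ((pair p z : ℝ) : ℂ))
      (Complex.ofRealCLM.comp (p.re • Complex.reCLM + p.im • Complex.imCLM)) z :=
    (Complex.ofRealCLM.comp (p.re • Complex.reCLM + p.im • Complex.imCLM)).hasFDerivAt
  have h2 := (h1.mul_const Complex.I).cexp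
  refine h2.congr_fderiv ?_
  ext v
  simp [wave]
  ring

theorem fderiv_wave_apply (p z v : ℂ) :
    fderiv ℝ (wave p) z v = Complex.I * pair p v * wave p z := by
  rw [(hasFDerivAt_wave p z).fderiv]
  simp [pair]
  ring

/-- The plane wave with wave vector `p ∈ Γ*`, as a function on the torus. -/
def char (p : dualModule) (q : Torus) : ℂ :=
  Quotient.liftOn' q (wave p) fun z w h => by
    have h1 : -z + w ∈ Γ := QuotientAddGroup.leftRel_apply.1 h
    have h2 : w = z + (-z + w) := by ring
    rw [h2, wave_add_right, wave_gamma p h1, mul_one]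

@[simp]
theorem char_coe (p : dualModule) (z : ℂ) : char p (z : Torus) = wave p z := rfl

theorem continuous_char (p : dualModule) : Continuous (char p) :=
  (contDiff_wave p).continuous.quotient_lift _

theorem char_add (p q : dualModule) (x : Torus) : char (p + q) x = char p x * char q x := by
  obtain ⟨z, rfl⟩ := QuotientAddGroup.mk_surjective x
  exact wave_add_left _ _ _

theorem char_add_right (p : dualModule) (x y : Torus) : char p (x + y) = char p x * char p y := by
  obtain ⟨z, rfl⟩ := QuotientAddGroup.mk_surjective x
  obtain ⟨w, rfl⟩ := QuotientAddGroup.mk_surjective y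
  exact wave_add_right _ _ _

theorem char_zero (x : Torus) : char 0 x = 1 := by
  obtain ⟨z, rfl⟩ := QuotientAddGroup.mk_surjective x
  exact wave_zero_left _

theorem conj_char (p : dualModule) (x : Torus) : conj (char p x) = char (-p) x := by
  obtain ⟨z, rfl⟩ := QuotientAddGroup.mk_surjective x
  exact conj_wave _ _

theorem norm_char (p : dualModule) (x : Torus) : ‖char p x‖ = 1 := by
  obtain ⟨z, rfl⟩ := QuotientAddGroup.mk_surjective x
  exact norm_wave _ _

/-- `char p` as a continuous map. -/
def charMap (p : dualModule) : C(Torus, ℂ) := ⟨char p, continuous_char p⟩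

theorem isSmooth_char (p : dualModule) : IsSmooth (char p) := contDiff_wave p

/-- The two dual generators suffice: where their characters agree, the difference of the points has
integer coordinates in `gen`. -/
theorem exists_char_ne {x y : Torus} (h : x ≠ y) : ∃ p, char p x ≠ char p y := by
  obtain ⟨z, rfl⟩ := QuotientAddGroup.mk_surjective x
  obtain ⟨w, rfl⟩ := QuotientAddGroup.mk_surjective y
  by_contra! hp
  apply h
  have key : ∀ i, ∃ n : ℤ, pair (dualGen i) (-z + w) = 2 * Real.pi * n := by
    intro i
    have hi : dualGen i ∈ dualModule := Submodule.subset_span ⟨i, by rw [coe_dualGenBasis]⟩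
    have h1 : wave (dualGen i) z = wave (dualGen i) w := hp ⟨dualGen i, hi⟩
    rw [← wave_eq_one_iff, wave_add_right, ← h1, ← wave_add_right, neg_add_cancel, wave_zero_right]
  obtain ⟨m, hm⟩ := key 0
  obtain ⟨n, hn⟩ := key 1
  refine QuotientAddGroup.eq.2 ((mem_Γ_iff _).2 ⟨m, n, ?_⟩)
  have hpi := Real.pi_pos
  conv_lhs => rw [sum_gen (-z + w)]
  rw [hm, hn, mul_div_cancel_left₀ _ (by positivity), mul_div_cancel_left₀ _ (by positivity)]
  simp

theorem integral_char (p : dualModule) :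
    ∫ x, char p x ∂torusMeasure = if p = 0 then (torusMeasure.real Set.univ : ℂ) else 0 := by
  split_ifs with h
  · simp [h, char_zero]
  · have : ∃ z, wave p z ≠ 1 := by
      by_contra! hz
      apply h
      -- A constant wave has derivative zero, which forces Re p = Im p = 0.
      have hd := fderiv_wave_apply p 0
      have h1 : wave p = fun _ => 1 := funext hz
      rw [h1] at hd
      have e1 := hd 1
      have e2 := hd Complex.I
      simp [pair] at e1 e2
      exact Subtype.ext (Complex.ext e1 e2)
    obtain ⟨z, hz⟩ := this
    -- Translation by z multiplies the integral by `wave p z` ≠ 1 and also preserves it.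
    have h1 := integral_add_right_eq_self (μ := torusMeasure) (char p) (z : Torus)
    simp_rw [char_add_right, char_coe] at h1
    rw [integral_mul_const] at h1
    by_contra h0
    exact hz (mul_left_cancel₀ h0 (h1.trans (mul_one _).symm))

/-! ### Completeness of the characters, by Stone–Weierstrass -/

/-- The star subalgebra of `C(ℂ / Γ)` spanned by the characters. -/
def charSubalgebra : StarSubalgebra ℂ C(Torus, ℂ) where
  toSubalgebra := Algebra.adjoin ℂ (Set.range charMap)
  star_mem' := by
    change Algebra.adjoin ℂ (Set.range charMap) ≤ star (Algebra.adjoin ℂ (Set.range charMap))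
    refine Algebra.adjoin_le ?_
    rintro _ ⟨n, rfl⟩
    refine Algebra.subset_adjoin ⟨-n, ?_⟩
    ext1 x
    exact (conj_char n x).symm

theorem charSubalgebra_coe :
    charSubalgebra.toSubalgebra.toSubmodule = Submodule.span ℂ (Set.range charMap) := by
  apply Algebra.adjoin_eq_span_of_subset
  refine .trans (fun x ↦ Submonoid.closure_induction (fun _ ↦ id) ⟨0, ?_⟩ ?_) Submodule.subset_span
  · ext z
    exact char_zero z
  · rintro _ _ _ _ ⟨m, rfl⟩ ⟨n, rfl⟩
    refine ⟨m + n, ?_⟩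
    ext z
    exact char_add m n z

theorem charSubalgebra_separatesPoints : charSubalgebra.SeparatesPoints := by
  intro x y hxy
  obtain ⟨p, hp⟩ := exists_char_ne hxy
  exact ⟨_, ⟨charMap p, Algebra.subset_adjoin ⟨p, rfl⟩, rfl⟩, hp⟩

theorem span_charMap_closure_eq_top :
    (Submodule.span ℂ (Set.range charMap)).topologicalClosure = ⊤ := by
  rw [← charSubalgebra_coe]
  exact congr_arg (Subalgebra.toSubmodule <| StarSubalgebra.toSubalgebra ·)
    (ContinuousMap.starSubalgebra_topologicalClosure_eq_top_of_separatesPoints _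
      charSubalgebra_separatesPoints)

/-- `char p` as an element of `L²`. -/
def charLp (p : dualModule) : L2 := ContinuousMap.toLp (E := ℂ) 2 torusMeasure ℂ (charMap p)

theorem coeFn_charLp (p : dualModule) : charLp p =ᵐ[torusMeasure] char p :=
  ContinuousMap.coeFn_toLp torusMeasure (charMap p)

theorem span_charLp_closure_eq_top :
    (Submodule.span ℂ (Set.range charLp)).topologicalClosure = ⊤ := by
  have := (ContinuousMap.toLp_denseRange ℂ torusMeasure ℂ (p := 2)
      (by simp)).topologicalClosure_map_submodule
      span_charMap_closure_eq_top
  rw [Submodule.map_span, ← Set.range_comp] at this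
  exact this

/-- The area of the torus. -/
def vol : ℝ := torusMeasure.real Set.univ

theorem vol_pos : 0 < vol :=
  ENNReal.toReal_pos (NeZero.ne _) (measure_ne_top _ _)

theorem inner_charLp (p q : dualModule) :
    inner ℂ (charLp p) (charLp q) = if p = q then (vol : ℂ) else 0 := by
  rw [charLp, charLp, ContinuousMap.inner_toLp]
  have : ∀ x, charMap q x * conj (charMap p x) = char (q - p) x := by
    intro x
    rw [sub_eq_add_neg, char_add, ← conj_char]
    rfl
  simp_rw [this, integral_char, sub_eq_zero, eq_comm (a := q)]
  rfl

theorem orthonormal_charLp : Orthonormal ℂ fun p => ((√vol)⁻¹ : ℂ) • charLp p := by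
  rw [orthonormal_iff_ite]
  intro p q
  rw [inner_smul_left, inner_smul_right, inner_charLp]
  split_ifs
  · have h : ((√vol : ℝ) : ℂ) * ((√vol : ℝ) : ℂ) = vol := by
      rw [← Complex.ofReal_mul, Real.mul_self_sqrt vol_pos.le]
    have h0 : ((√vol : ℝ) : ℂ) ≠ 0 := by
      exact_mod_cast (Real.sqrt_pos.2 vol_pos).ne'
    rw [← h, map_inv₀, Complex.conj_ofReal]
    field_simp
  · simp

/-- The Hilbert basis of normalised characters. -/
def charBasis : HilbertBasis dualModule ℂ L2 :=
  HilbertBasis.mk orthonormal_charLp (by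
    rw [← span_charLp_closure_eq_top]
    refine Submodule.topologicalClosure_mono (Submodule.span_le.2 ?_)
    rintro _ ⟨p, rfl⟩
    have h0 : ((√vol : ℝ) : ℂ) ≠ 0 := by
      exact_mod_cast (Real.sqrt_pos.2 vol_pos).ne'
    have : charLp p = ((√vol : ℝ) : ℂ) • (((√vol)⁻¹ : ℂ) • charLp p) := by
      rw [smul_smul, mul_inv_cancel₀ h0, one_smul]
    rw [this]
    exact Submodule.smul_mem _ _ (Submodule.subset_span ⟨p, rfl⟩))

theorem charBasis_apply (p : dualModule) : charBasis p = ((√vol)⁻¹ : ℂ) • charLp p := by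
  rw [charBasis, HilbertBasis.coe_mk]

/-! ### Fourier coefficients -/

/-- The Fourier coefficients of a function on the torus. -/
def coeff (f : Torus → ℂ) (p : dualModule) : ℂ :=
  (vol : ℂ)⁻¹ * ∫ x, char (-p) x * f x ∂torusMeasure

theorem coeff_congr {f g : Torus → ℂ} (h : f =ᵐ[torusMeasure] g) : coeff f = coeff g := by
  funext p
  rw [coeff, coeff]
  congr 1
  refine integral_congr_ae ?_
  filter_upwards [h] with x hx
  rw [hx]

/-- The factor arises because `coeff` is normalised for expansions in the characters themselves,
which have norm √vol. -/
theorem coeff_eq (u : L2) (p : dualModule) : coeff u p = (√vol : ℂ)⁻¹ * charBasis.repr u p := by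
  rw [charBasis.repr_apply_apply, charBasis_apply, inner_smul_left, L2.inner_def, ← mul_assoc,
      coeff]
  congr 1
  · rw [map_inv₀, Complex.conj_ofReal, ← mul_inv, ← Complex.ofReal_mul,
        Real.mul_self_sqrt vol_pos.le]
  · refine integral_congr_ae ?_
    filter_upwards [coeFn_charLp p] with x hx
    rw [RCLike.inner_apply, hx, conj_char, mul_comm]

theorem sqrt_vol_ne_zero : ((√vol : ℝ) : ℂ) ≠ 0 := by
  exact_mod_cast (Real.sqrt_pos.2 vol_pos).ne'

theorem repr_eq (u : L2) (p : dualModule) : charBasis.repr u p = √vol * coeff u p := by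
  rw [coeff_eq, ← mul_assoc, mul_inv_cancel₀ sqrt_vol_ne_zero, one_mul]

theorem coeff_ext {u v : L2} (h : ∀ p, coeff u p = coeff v p) : u = v := by
  apply charBasis.repr.injective
  ext p
  rw [repr_eq, repr_eq, h]

theorem coeff_add (u v : L2) (p : dualModule) :
    coeff (u + v : L2) p = coeff u p + coeff v p := by
  simp only [coeff_eq, map_add, lp.coeFn_add, Pi.add_apply, mul_add]

theorem coeff_smul (c : ℂ) (u : L2) (p : dualModule) : coeff (c • u : L2) p = c * coeff u p := by
  simp only [coeff_eq, map_smul, lp.coeFn_smul, Pi.smul_apply, smul_eq_mul]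
  ring

theorem coeff_zero (p : dualModule) : coeff (0 : L2) p = 0 := by
  rw [coeff_eq, map_zero, lp.coeFn_zero, Pi.zero_apply, mul_zero]

theorem memℓp_coeff (u : L2) : Memℓp (coeff u) 2 := by
  have h : coeff u = (√vol : ℂ)⁻¹ • ⇑(charBasis.repr u) := by
    funext p; exact coeff_eq u p
  rw [h]
  exact (lp.memℓp _).const_smul _

theorem exists_coeff_eq {x : dualModule → ℂ} (hx : Memℓp x 2) : ∃ u : L2, ∀ p, coeff u p = x p := by
  refine ⟨charBasis.repr.symm ⟨_, hx.const_smul (√vol : ℂ)⟩, fun p => ?_⟩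
  rw [coeff_eq, LinearIsometryEquiv.apply_symm_apply]
  change _ * ((√vol : ℂ) • x) p = _
  rw [Pi.smul_apply, smul_eq_mul, ← mul_assoc, inv_mul_cancel₀ sqrt_vol_ne_zero, one_mul]

theorem norm_sq_eq (u : L2) : ‖u‖ ^ 2 = vol * ∑' p, ‖coeff u p‖ ^ 2 := by
  have h := lp.norm_rpow_eq_tsum (p := 2) (by norm_num) (charBasis.repr u)
  rw [LinearIsometryEquiv.norm_map] at h
  simp only [ENNReal.toReal_ofNat, Real.rpow_ofNat] at h
  rw [h, ← tsum_mul_left]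
  congr 1
  funext p
  rw [repr_eq, norm_mul, mul_pow, Complex.norm_real, Real.norm_of_nonneg (Real.sqrt_nonneg _),
    Real.sq_sqrt vol_pos.le]

theorem summable_norm_sq_coeff (u : L2) : Summable fun p => ‖coeff u p‖ ^ 2 := by
  have := (memℓp_coeff u).summable (by norm_num)
  simpa using this

theorem norm_coeff_le (u : L2) (p : dualModule) : ‖coeff u p‖ ≤ (√vol)⁻¹ * ‖u‖ := by
  have h := (lp.norm_apply_le_norm (p := 2) (by norm_num) (charBasis.repr u) p)
  rw [LinearIsometryEquiv.norm_map] at h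
  rw [coeff_eq, norm_mul, norm_inv, Complex.norm_real, Real.norm_of_nonneg (Real.sqrt_nonneg _)]
  gcongr

theorem coeff_charLp (p q : dualModule) : coeff (charLp p) q = if q = p then 1 else 0 := by
  rw [coeff_eq, charBasis.repr_apply_apply, charBasis_apply, inner_smul_left, inner_charLp]
  split_ifs
  · rw [map_inv₀, Complex.conj_ofReal, ← mul_assoc, ← mul_inv, ← Complex.ofReal_mul,
      Real.mul_self_sqrt vol_pos.le, inv_mul_cancel₀]
    exact_mod_cast vol_pos.ne'
  · simp

/-- Parseval's identity for the bilinear pairing. -/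
theorem hasSum_coeff_mul (u v : L2) :
    HasSum (fun p => coeff u (-p) * coeff v p) ((vol : ℂ)⁻¹ * ∫ x, u x * v x ∂torusMeasure) := by
  -- The bilinear pairing of u and v is the inner product of ū with v, and conjugation exchanges the
  -- modes p and -p.
  have hu : MemLp (fun x => conj (u x)) 2 torusMeasure := (Lp.memLp u).star
  have h := (charBasis.hasSum_inner_mul_inner hu.toLp v).mul_left (vol : ℂ)⁻¹
  have h0 : (vol : ℂ)⁻¹ = (√vol : ℂ)⁻¹ * (√vol : ℂ)⁻¹ := by
    rw [← mul_inv, ← Complex.ofReal_mul, Real.mul_self_sqrt vol_pos.le]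
  have e1 : (fun p => coeff u (-p) * coeff v p) = fun p => (vol : ℂ)⁻¹ *
      (inner ℂ hu.toLp (charBasis p) * inner ℂ (charBasis p) v) := by
    funext p
    rw [← charBasis.repr_apply_apply, ← inner_conj_symm, ← charBasis.repr_apply_apply, repr_eq,
      repr_eq, h0]
    have : conj (coeff hu.toLp p) = coeff u (-p) := by
      rw [coeff_congr hu.coeFn_toLp, coeff, coeff, map_mul, map_inv₀, Complex.conj_ofReal,
        ← integral_conj]
      simp_rw [map_mul, Complex.conj_conj, conj_char]
    rw [map_mul, Complex.conj_ofReal, this]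
    linear_combination (-(coeff u (-p) * coeff v p) * ((√vol : ℂ)⁻¹ * √vol + 1)) *
      inv_mul_cancel₀ sqrt_vol_ne_zero
  have e2 : ∫ x, u x * v x ∂torusMeasure = inner ℂ hu.toLp v := by
    rw [L2.inner_def]
    refine integral_congr_ae ?_
    filter_upwards [hu.coeFn_toLp] with x hx
    rw [RCLike.inner_apply, hx, Complex.conj_conj, mul_comm]
  rw [e1, e2]
  exact h

/-! ### Derivatives of smooth functions on the torus -/

theorem continuous_of_coe {f : Torus → ℂ} (h : Continuous fun z : ℂ => f (z : Torus)) :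
    Continuous f :=
  QuotientAddGroup.isOpenQuotientMap_mk.isQuotientMap.continuous_iff.2 h

theorem IsSmooth.continuous' {f : Torus → ℂ} (hf : IsSmooth f) : Continuous f :=
  continuous_of_coe hf.continuous

theorem IsSmooth.hasDerivAt {f : Torus → ℂ} (hf : IsSmooth f) (v z : ℂ) (t : ℝ) :
    HasDerivAt (fun t : ℝ => f ((z : Torus) + (((t : ℂ) * v : ℂ) : Torus)))
      (fderiv ℝ (fun z : ℂ => f (z : Torus)) (z + t * v) v) t := by
  have hd : DifferentiableAt ℝ (fun z : ℂ => f (z : Torus)) (z + t * v) :=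
    (hf.differentiable (by simp)) _
  have h1 : HasDerivAt (fun t : ℝ => z + (t : ℂ) * v) v t := by
    have := ((hasDerivAt_id t).ofReal_comp.mul_const v).const_add z
    simpa using this
  exact hd.hasFDerivAt.comp_hasDerivAt t h1

theorem IsSmooth.dirDeriv_coe {f : Torus → ℂ} (hf : IsSmooth f) (v z : ℂ) :
    dirDeriv v f (z : Torus) = fderiv ℝ (fun z : ℂ => f (z : Torus)) z v := by
  have := (hf.hasDerivAt v z 0).deriv
  simpa [dirDeriv] using this

theorem IsSmooth.dirDeriv {f : Torus → ℂ} (hf : IsSmooth f) (v : ℂ) : IsSmooth (dirDeriv v f) := by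
  unfold IsSmooth
  simp_rw [hf.dirDeriv_coe]
  exact (hf.fderiv_right (by simp)).clm_apply contDiff_const

theorem IsSmooth.mul {f g : Torus → ℂ} (hf : IsSmooth f) (hg : IsSmooth g) :
    IsSmooth fun x => f x * g x := ContDiff.mul hf hg

theorem IsSmooth.const_mul {f : Torus → ℂ} (hf : IsSmooth f) (c : ℂ) :
    IsSmooth fun x => c * f x := ContDiff.mul contDiff_const hf

theorem IsSmooth.neg_arg {f : Torus → ℂ} (hf : IsSmooth f) : IsSmooth fun x => f (-x) :=
  ContDiff.comp (g := fun z : ℂ => f (z : Torus)) hf contDiff_neg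

/-- The integral of a translate of f does not depend on the translation; differentiate it at t = 0
under the integral sign. -/
theorem integral_dirDeriv {f : Torus → ℂ} (hf : IsSmooth f) (v : ℂ) :
    ∫ x, dirDeriv v f x ∂torusMeasure = 0 := by
  have hc : Continuous (TBG.dirDeriv v f) := (hf.dirDeriv v).continuous'
  obtain ⟨C, hC⟩ := isCompact_univ.exists_bound_of_continuousOn hc.continuousOn
  have hint : ∀ {g : Torus → ℂ}, Continuous g → Integrable g torusMeasure := fun hg =>
    (memLp_of_continuous (hg.comp QuotientAddGroup.continuous_mk)).integrable (by norm_num)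
  have hq : Continuous fun x : Torus × ℝ => x.1 + (((x.2 : ℂ) * v : ℂ) : Torus) :=
    continuous_fst.add (QuotientAddGroup.continuous_mk.comp (by fun_prop))
  have h := hasDerivAt_integral_of_dominated_loc_of_deriv_le (μ := torusMeasure) (x₀ := (0 : ℝ))
    (F := fun (t : ℝ) x => f (x + (((t : ℂ) * v : ℂ) : Torus)))
    (F' := fun (t : ℝ) x => TBG.dirDeriv v f (x + (((t : ℂ) * v : ℂ) : Torus)))
    (bound := fun _ => C) Filter.univ_mem
    (Filter.Eventually.of_forall fun t => Continuous.aestronglyMeasurable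
      (hf.continuous'.comp (hq.comp (by fun_prop : Continuous fun x : Torus => (x, t)))))
    (hint (hf.continuous'.comp (hq.comp (by fun_prop : Continuous fun x : Torus => (x, (0 : ℝ))))))
    (Continuous.aestronglyMeasurable
      (hc.comp (hq.comp (by fun_prop : Continuous fun x : Torus => (x, (0 : ℝ))))))
    (Filter.Eventually.of_forall fun x t _ => hC _ (Set.mem_univ _)) (integrable_const C)
    (Filter.Eventually.of_forall fun x t _ => by
      obtain ⟨z, rfl⟩ := QuotientAddGroup.mk_surjective x
      have := hf.hasDerivAt v z t
      rw [← hf.dirDeriv_coe] at this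
      exact this)
  have h2 := h.2
  simp_rw [integral_add_right_eq_self] at h2
  have h3 := h2.unique (hasDerivAt_const (0 : ℝ) _)
  exact h3

theorem dirDeriv_mul {f g : Torus → ℂ} (hf : IsSmooth f) (hg : IsSmooth g) (v : ℂ) (x : Torus) :
    dirDeriv v (fun x => f x * g x) x = dirDeriv v f x * g x + f x * dirDeriv v g x := by
  obtain ⟨z, rfl⟩ := QuotientAddGroup.mk_surjective x
  rw [(hf.mul hg).dirDeriv_coe, hf.dirDeriv_coe, hg.dirDeriv_coe]
  have h1 : DifferentiableAt ℝ (fun z : ℂ => f (z : Torus)) z := (hf.differentiable (by simp)) _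
  have h2 : DifferentiableAt ℝ (fun z : ℂ => g (z : Torus)) z := (hg.differentiable (by simp)) _
  rw [fderiv_fun_mul h1 h2]
  simp
  ring

theorem dirDeriv_char (p : dualModule) (v : ℂ) (x : Torus) :
    dirDeriv v (char p) x = Complex.I * pair p v * char p x := by
  obtain ⟨z, rfl⟩ := QuotientAddGroup.mk_surjective x
  rw [(isSmooth_char p).dirDeriv_coe]
  exact fderiv_wave_apply _ _ _

theorem integrable_of_continuous {g : Torus → ℂ} (hg : Continuous g) : Integrable g torusMeasure :=
  (memLp_of_continuous (hg.comp QuotientAddGroup.continuous_mk)).integrable (by norm_num)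

/-- Integration by parts: the derivative of `char (-p)` times f has integral zero. -/
theorem coeff_dirDeriv {f : Torus → ℂ} (hf : IsSmooth f) (v : ℂ) (p : dualModule) :
    coeff (dirDeriv v f) p = Complex.I * pair p v * coeff f p := by
  have h := integral_dirDeriv ((isSmooth_char (-p)).mul hf) v
  simp_rw [dirDeriv_mul (isSmooth_char (-p)) hf] at h
  have hn : pair ((-p : dualModule) : ℂ) v = -pair p v := pair_neg_left _ _
  rw [integral_add (integrable_of_continuous
    ((((isSmooth_char (-p)).dirDeriv v).mul hf).continuous'))
    (integrable_of_continuous (((isSmooth_char (-p)).mul (hf.dirDeriv v)).continuous'))] at h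
  simp_rw [dirDeriv_char, mul_assoc, hn] at h
  rw [integral_const_mul, integral_const_mul] at h
  rw [coeff, coeff]
  push_cast at h
  linear_combination (vol : ℂ)⁻¹ * h

/-! ### Decay of Fourier coefficients -/

/-- Sequences on the dual lattice that decay faster than any power. -/
def RapidDecay (x : dualModule → ℂ) : Prop :=
  ∀ M : ℕ, ∃ C, ∀ p, ‖x p‖ * (1 + ‖(p : ℂ)‖) ^ M ≤ C

theorem exists_norm_coeff_le {f : Torus → ℂ} (hf : Continuous f) : ∃ C, ∀ p, ‖coeff f p‖ ≤ C := by
  have hm := memLp_of_continuous (hf.comp QuotientAddGroup.continuous_mk)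
  refine ⟨(√vol)⁻¹ * ‖hm.toLp‖, fun p => ?_⟩
  rw [← coeff_congr hm.coeFn_toLp]
  exact norm_coeff_le _ _

/-- Each differentiation buys one power of |p|, because |p| ≤ |Re p| + |Im p| and the two partial
derivatives multiply coefficients by i Re p and i Im p. -/
theorem IsSmooth.rapidDecay {f : Torus → ℂ} (hf : IsSmooth f) : RapidDecay (coeff f) := by
  intro M
  induction M generalizing f with
  | zero => simpa using exists_norm_coeff_le hf.continuous'
  | succ M ih =>
    obtain ⟨C, hC⟩ := ih hf
    obtain ⟨C1, hC1⟩ := ih (hf.dirDeriv 1)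
    obtain ⟨C2, hC2⟩ := ih (hf.dirDeriv Complex.I)
    refine ⟨C + (C1 + C2), fun p => ?_⟩
    have h1 := hC1 p
    have h2 := hC2 p
    rw [coeff_dirDeriv hf, norm_mul, norm_mul, Complex.norm_I, one_mul, Complex.norm_real,
      Real.norm_eq_abs] at h1 h2
    have e1 : pair p 1 = (p : ℂ).re := by simp [pair]
    have e2 : pair p Complex.I = (p : ℂ).im := by simp [pair]
    rw [e1] at h1
    rw [e2] at h2
    have h3 := Complex.norm_le_abs_re_add_abs_im (p : ℂ)
    have h0 : 0 ≤ ‖coeff f p‖ * (1 + ‖(p : ℂ)‖) ^ M := by positivity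
    calc ‖coeff f p‖ * (1 + ‖(p : ℂ)‖) ^ (M + 1)
        = ‖coeff f p‖ * (1 + ‖(p : ℂ)‖) ^ M +
          ‖coeff f p‖ * (1 + ‖(p : ℂ)‖) ^ M * ‖(p : ℂ)‖ := by ring
      _ ≤ ‖coeff f p‖ * (1 + ‖(p : ℂ)‖) ^ M +
          ‖coeff f p‖ * (1 + ‖(p : ℂ)‖) ^ M * (|(p : ℂ).re| + |(p : ℂ).im|) := by gcongr
      _ = ‖coeff f p‖ * (1 + ‖(p : ℂ)‖) ^ M + (|(p : ℂ).re| * ‖coeff f p‖ * (1 + ‖(p : ℂ)‖) ^ M +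
          |(p : ℂ).im| * ‖coeff f p‖ * (1 + ‖(p : ℂ)‖) ^ M) := by ring
      _ ≤ C + (C1 + C2) := add_le_add (hC p) (add_le_add h1 h2)

theorem summable_of_norm_mul_le {x : dualModule → ℂ} {C : ℝ}
    (h : ∀ p, ‖x p‖ * (1 + ‖(p : ℂ)‖) ^ 3 ≤ C) : Summable fun p => ‖x p‖ := by
  refine Summable.of_nonneg_of_le (fun _ => norm_nonneg _) (fun p => ?_)
    (summable_one_add_norm_inv.mul_left C)
  rw [← div_eq_mul_inv, le_div_iff₀ (by positivity)]
  exact h p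

theorem RapidDecay.summable {x : dualModule → ℂ} (hx : RapidDecay x) : Summable fun p => ‖x p‖ := by
  obtain ⟨C, hC⟩ := hx 3
  exact summable_of_norm_mul_le hC

theorem RapidDecay.mul_norm_pow {x : dualModule → ℂ} (hx : RapidDecay x) (N : ℕ) :
    RapidDecay fun p => x p * ((1 + ‖(p : ℂ)‖ : ℝ) : ℂ) ^ N := by
  intro M
  obtain ⟨C, hC⟩ := hx (N + M)
  refine ⟨C, fun p => ?_⟩
  rw [norm_mul, norm_pow, Complex.norm_real, Real.norm_of_nonneg (by positivity), mul_assoc,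
    ← pow_add]
  exact hC p

theorem RapidDecay.memℓp {x : dualModule → ℂ} (hx : RapidDecay x) : Memℓp x 2 := by
  have h1 : Memℓp x 1 := memℓp_gen (by simpa using hx.summable)
  exact h1.of_exponent_ge (by norm_num)

/-- Fourier inversion for smooth functions. -/
theorem IsSmooth.hasSum_coeff {f : Torus → ℂ} (hf : IsSmooth f) (z : ℂ) :
    HasSum (fun p : dualModule => coeff f p * wave p z) (f (z : Torus)) := by
  let F : C(Torus, ℂ) := ⟨f, hf.continuous'⟩
  have h1 := charBasis.hasSum_repr (ContinuousMap.toLp (E := ℂ) 2 torusMeasure ℂ F)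
  have h2 : (fun p => charBasis.repr (ContinuousMap.toLp (E := ℂ) 2 torusMeasure ℂ F) p •
      charBasis p) = fun p => ContinuousMap.toLp (E := ℂ) 2 torusMeasure ℂ (coeff f p • charMap p)
          := by
    funext p
    rw [repr_eq, charBasis_apply, coeff_congr (ContinuousMap.coeFn_toLp torusMeasure F), smul_smul,
      mul_right_comm, mul_inv_cancel₀ sqrt_vol_ne_zero, one_mul, map_smul]
    rfl
  rw [h2] at h1
  -- Absolute convergence in the sup norm upgrades the L² expansion to a uniform one, which can be
  -- evaluated at a point.
  have h3 : HasSum (fun p => coeff f p • charMap p) F := by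
    refine ContinuousMap.hasSum_of_hasSum_Lp (.of_norm ?_) h1
    refine Summable.of_nonneg_of_le (fun _ => norm_nonneg _) (fun p => ?_) hf.rapidDecay.summable
    rw [norm_smul]
    refine mul_le_of_le_one_right (norm_nonneg _) ?_
    exact (ContinuousMap.norm_le _ zero_le_one).2 fun x => (norm_char p x).le
  have h4 := (ContinuousMap.evalCLM ℂ (z : Torus)).hasSum h3
  exact h4

/-! ### The operators on the Fourier side -/

/-- Testing against `char (-p)` isolates the mode p; conversely, Parseval turns both integrals into
sums that agree term by term. -/
theorem isWeakDeriv_iff (v : ℂ) (u w : L2) :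
    IsWeakDeriv v u w ↔ ∀ p : dualModule, coeff w p = Complex.I * pair p v * coeff u p := by
  constructor
  · intro h p
    have h1 := h (char (-p)) (isSmooth_char _)
    have hn : pair ((-p : dualModule) : ℂ) v = -pair p v := pair_neg_left _ _
    simp_rw [dirDeriv_char, hn] at h1
    have e1 : ∀ x, u x * (Complex.I * ((-pair p v : ℝ) : ℂ) * char (-p) x) =
        -(Complex.I * pair p v) * (char (-p) x * u x) := by intro x; push_cast; ring
    simp_rw [e1, mul_comm (w _)] at h1
    rw [integral_const_mul] at h1
    rw [coeff, coeff]
    linear_combination (vol : ℂ)⁻¹ * h1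
  · intro h φ hφ
    have m1 := memLp_of_continuous hφ.continuous
    have m2 := memLp_of_continuous (hφ.continuous_dirDeriv v)
    have s1 := hasSum_coeff_mul w m1.toLp
    have s2 := hasSum_coeff_mul u m2.toLp
    have e1 : ∫ x, w x * (m1.toLp : L2) x ∂torusMeasure = ∫ x, w x * φ x ∂torusMeasure := by
      refine integral_congr_ae ?_
      filter_upwards [m1.coeFn_toLp] with x hx
      rw [hx]
    have e2 : ∫ x, u x * (m2.toLp : L2) x ∂torusMeasure = ∫ x,
        u x * dirDeriv v φ x ∂torusMeasure := by
      refine integral_congr_ae ?_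
      filter_upwards [m2.coeFn_toLp] with x hx
      rw [hx]
    rw [e1] at s1
    rw [e2] at s2
    have hv : (vol : ℂ)⁻¹ ≠ 0 := inv_ne_zero (by exact_mod_cast vol_pos.ne')
    have h3 := s2.unique (s1.neg.congr_fun fun p => ?_)
    · rw [← mul_neg] at h3
      exact mul_left_cancel₀ hv h3
    · have hn : pair ((-p : dualModule) : ℂ) v = -pair p v := pair_neg_left _ _
      rw [coeff_congr m1.coeFn_toLp, coeff_congr m2.coeFn_toLp, coeff_dirDeriv hφ, h, hn]
      push_cast
      ring

theorem weakDerivGraph_snd_eq_zero (v : ℂ) :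
    ∀ x : L2 × L2, x ∈ weakDerivGraph v → x.1 = 0 → x.2 = 0 := by
  rintro ⟨u, w⟩ h rfl
  have := (isWeakDeriv_iff v 0 w).1 h
  refine coeff_ext fun p => ?_
  rw [this, coeff_zero, mul_zero]

theorem mem_weakDeriv_domain_iff (v : ℂ) (u : L2) :
    u ∈ (weakDeriv v).domain ↔ ∃ w, IsWeakDeriv v u w := by
  rw [weakDeriv, Submodule.toLinearPMap_domain]
  simp only [Submodule.mem_map, LinearMap.fst_apply, Prod.exists, exists_and_right, exists_eq_right]
  rfl

theorem coeff_weakDeriv (v : ℂ) (u : (weakDeriv v).domain) (p : dualModule) :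
    coeff (weakDeriv v u) p = Complex.I * pair p v * coeff u p :=
  (isWeakDeriv_iff v u _).1
    (Submodule.mem_graph_toLinearPMap (weakDerivGraph_snd_eq_zero v) u) p

theorem mem_weakDeriv_domain_iff_memℓp (v : ℂ) (u : L2) :
    u ∈ (weakDeriv v).domain ↔ Memℓp (fun p : dualModule => Complex.I * pair p v * coeff u p)
        2 := by
  rw [mem_weakDeriv_domain_iff]
  simp_rw [isWeakDeriv_iff]
  constructor
  · rintro ⟨w, hw⟩
    simp_rw [← hw]
    exact memℓp_coeff w
  · exact exists_coeff_eq

theorem memℓp_of_norm_le {x y : dualModule → ℂ} (hy : Memℓp y 2) (h : ∀ p, ‖x p‖ ≤ ‖y p‖) :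
    Memℓp x 2 := by
  refine memℓp_gen (Summable.of_nonneg_of_le (fun _ => by positivity) (fun p => ?_)
    (hy.summable (by norm_num)))
  exact Real.rpow_le_rpow (norm_nonneg _) (h p) (by norm_num)

theorem coeff_two_smul_Dbar (u : ((2 : ℂ) • Dbar).domain) (p : dualModule) :
    coeff (((2 : ℂ) • Dbar) u) p = p * coeff u p := by
  have h1 := coeff_weakDeriv 1 ⟨u, u.2.1⟩ p
  have h2 := coeff_weakDeriv Complex.I ⟨u, u.2.2⟩ p
  have e : ((2 : ℂ) • Dbar) u = (2 : ℂ) • (1 / (2 * Complex.I)) •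
      (weakDeriv 1 ⟨u, u.2.1⟩ + Complex.I • weakDeriv Complex.I ⟨u, u.2.2⟩) := rfl
  rw [e, coeff_smul, coeff_smul, coeff_add, coeff_smul, h1, h2]
  have e1 : pair p 1 = (p : ℂ).re := by simp [pair]
  have e2 : pair p Complex.I = (p : ℂ).im := by simp [pair]
  rw [e1, e2]
  have hI := Complex.I_ne_zero
  field_simp
  linear_combination (coeff u p) * Complex.re_add_im (p : ℂ)

/-- Ellipticity: the symbol p of `2 D_{z̄}` dominates Re p and Im p, so controlling this one
operator controls both partial derivatives. -/
theorem mem_two_smul_Dbar_domain_iff (u : L2) :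
    u ∈ ((2 : ℂ) • Dbar).domain ↔ Memℓp (fun p : dualModule => (p : ℂ) * coeff u p) 2 := by
  constructor
  · intro h
    have := memℓp_coeff (((2 : ℂ) • Dbar) ⟨u, h⟩)
    refine memℓp_of_norm_le this fun p => ?_
    rw [coeff_two_smul_Dbar]
  · intro h
    have e : u ∈ ((2 : ℂ) • Dbar).domain ↔
        u ∈ (weakDeriv 1).domain ∧ u ∈ (weakDeriv Complex.I).domain := Iff.rfl
    rw [e, mem_weakDeriv_domain_iff_memℓp, mem_weakDeriv_domain_iff_memℓp]
    constructor
    · refine memℓp_of_norm_le h fun p => ?_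
      rw [norm_mul, norm_mul, norm_mul, Complex.norm_I, one_mul, Complex.norm_real]
      gcongr
      simpa [pair] using Complex.abs_re_le_norm (p : ℂ)
    · refine memℓp_of_norm_le h fun p => ?_
      rw [norm_mul, norm_mul, norm_mul, Complex.norm_I, one_mul, Complex.norm_real]
      gcongr
      simpa [pair] using Complex.abs_im_le_norm (p : ℂ)

theorem mulOp_domain {f : Torus → ℂ} (hf : Continuous f) : (mulOp f).domain = ⊤ := by
  rw [eq_top_iff]
  intro u _
  obtain ⟨C, hC⟩ := isCompact_univ.exists_bound_of_continuousOn hf.continuousOn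
  refine (Lp.memLp u).of_le_mul (c := C)
    (hf.aestronglyMeasurable.mul (Lp.memLp u).aestronglyMeasurable)
    (Filter.Eventually.of_forall fun x => ?_)
  rw [norm_mul]
  exact mul_le_mul_of_nonneg_right (hC x trivial) (norm_nonneg _)

/-- Convolution of sequences on the dual lattice. -/
def conv (a x : dualModule → ℂ) (p : dualModule) : ℂ := ∑' q, a (p - q) * x q

/-- Parseval for u against `char (-p)` times f, whose coefficient at -q is that of f at p - q. -/
theorem coeff_mulOp {f : Torus → ℂ} (hf : Continuous f) (u : (mulOp f).domain) (p : dualModule) :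
    coeff (mulOp f u) p = conv (coeff f) (coeff u) p := by
  have e1 : coeff (mulOp f u) = coeff fun x => f x * (u : L2) x :=
    coeff_congr (MemLp.coeFn_toLp u.2)
  have m := memLp_of_continuous
    (((continuous_char (-p)).mul hf).comp QuotientAddGroup.continuous_mk)
  have s := (hasSum_coeff_mul m.toLp u).tsum_eq
  rw [e1, conv, coeff]
  have e2 : ∫ x, (m.toLp : L2) x * (u : L2) x ∂torusMeasure =
      ∫ x, char (-p) x * (f x * (u : L2) x) ∂torusMeasure := by
    refine integral_congr_ae ?_
    filter_upwards [m.coeFn_toLp] with x hx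
    rw [hx]
    exact mul_assoc _ _ _
  rw [← e2, ← s]
  refine tsum_congr fun q => ?_
  rw [coeff_congr m.coeFn_toLp, coeff, coeff]
  congr 2
  refine integral_congr_ae (Filter.Eventually.of_forall fun x => ?_)
  change char (- -q) x * (char (-p) x * f x) = char (-(p - q)) x * f x
  rw [← mul_assoc, ← char_add]
  congr 2
  abel

/-! ### Convolution of sequences on the dual lattice -/

/-- The change of variable `q ↦ p - q` on the dual lattice. -/
theorem summable_comp_sub {f : dualModule → ℝ} (hf : Summable f) (p : dualModule) :
    Summable fun q => f (p - q) := (Equiv.subLeft p).summable_iff.2 hf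

theorem tsum_comp_sub (f : dualModule → ℝ) (p : dualModule) : ∑' q, f (p - q) = ∑' q, f q :=
  (Equiv.subLeft p).tsum_eq f

theorem summable_conv_of_bounded_right {a x : dualModule → ℂ} (ha : Summable fun p => ‖a p‖) {C : ℝ}
    (hx : ∀ p, ‖x p‖ ≤ C) (p : dualModule) : Summable fun q => ‖a (p - q) * x q‖ := by
  refine Summable.of_nonneg_of_le (fun _ => norm_nonneg _) (fun q => ?_)
    ((summable_comp_sub ha p).mul_right C)
  rw [norm_mul]
  exact mul_le_mul_of_nonneg_left (hx q) (norm_nonneg _)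

theorem summable_conv_of_bounded_left {a x : dualModule → ℂ} (hx : Summable fun p => ‖x p‖) {C : ℝ}
    (ha : ∀ p, ‖a p‖ ≤ C) (p : dualModule) : Summable fun q => ‖a (p - q) * x q‖ := by
  refine Summable.of_nonneg_of_le (fun _ => norm_nonneg _) (fun q => ?_) (hx.mul_left C)
  rw [norm_mul]
  exact mul_le_mul_of_nonneg_right (ha _) (norm_nonneg _)

theorem norm_conv_le {a x : dualModule → ℂ} (hx : Summable fun p => ‖x p‖) {C : ℝ}
    (ha : ∀ p, ‖a p‖ ≤ C) (p : dualModule) : ‖conv a x p‖ ≤ C * ∑' q, ‖x q‖ := by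
  have h := summable_conv_of_bounded_left hx ha p
  refine (norm_tsum_le_tsum_norm h).trans ?_
  rw [← tsum_mul_left]
  refine h.tsum_le_tsum (fun q => ?_) (hx.mul_left C)
  rw [norm_mul]
  exact mul_le_mul_of_nonneg_right (ha _) (norm_nonneg _)

theorem one_add_norm_pow_le (p q : ℂ) (M : ℕ) :
    (1 + ‖p‖) ^ M ≤ (1 + ‖p - q‖) ^ M * (1 + ‖q‖) ^ M := by
  rw [← mul_pow]
  gcongr
  have : ‖p‖ ≤ ‖p - q‖ + ‖q‖ := by simpa using norm_add_le (p - q) q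
  nlinarith [norm_nonneg (p - q), norm_nonneg q]

/-- The weight (1 + |p|)^M is submultiplicative, so it can be distributed over the two factors of
the convolution. -/
theorem exists_norm_conv_mul_le {a x : dualModule → ℂ} (ha : RapidDecay a) (M : ℕ) {C : ℝ}
    (hx : ∀ p, ‖x p‖ * (1 + ‖(p : ℂ)‖) ^ M ≤ C) :
    ∃ C', ∀ p, ‖conv a x p‖ * (1 + ‖(p : ℂ)‖) ^ M ≤ C' := by
  have hA := (ha.mul_norm_pow M).summable
  refine ⟨(∑' q, ‖a q * ((1 + ‖(q : ℂ)‖ : ℝ) : ℂ) ^ M‖) * C, fun p => ?_⟩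
  have hx' : ∀ q, ‖x q‖ ≤ C := fun q =>
    (le_mul_of_one_le_right (norm_nonneg _)
      (one_le_pow₀ (by linarith [norm_nonneg (q : ℂ)]))).trans (hx q)
  have h := summable_conv_of_bounded_right ha.summable hx' p
  rw [← tsum_comp_sub _ p, ← tsum_mul_right]
  refine (mul_le_mul_of_nonneg_right (norm_tsum_le_tsum_norm h) (by positivity)).trans ?_
  rw [← tsum_mul_right]
  refine (h.mul_right _).tsum_le_tsum (fun q => ?_) ((summable_comp_sub hA p).mul_right C)
  rw [norm_mul, norm_mul, norm_pow, Complex.norm_real, Real.norm_of_nonneg (by positivity)]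
  calc ‖a (p - q)‖ * ‖x q‖ * (1 + ‖(p : ℂ)‖) ^ M
      ≤ ‖a (p - q)‖ * ‖x q‖ * ((1 + ‖(p : ℂ) - q‖) ^ M * (1 + ‖(q : ℂ)‖) ^ M) := by
        gcongr
        exact one_add_norm_pow_le _ _ _
    _ = ‖a (p - q)‖ * (1 + ‖(p : ℂ) - q‖) ^ M * (‖x q‖ * (1 + ‖(q : ℂ)‖) ^ M) := by ring
    _ ≤ ‖a (p - q)‖ * (1 + ‖(p : ℂ) - q‖) ^ M * C := by gcongr; exact hx q

/-- For functions this says that multiplication by the Green function commutes with multiplication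
by the potential. As g is only assumed bounded, it is proved by a change of variable in an
absolutely convergent double sum. -/
theorem conv_conv {g a y : dualModule → ℂ} {C : ℝ} (hg : ∀ p, ‖g p‖ ≤ C)
    (ha : Summable fun p => ‖a p‖) (hy : Summable fun p => ‖y p‖) (p : dualModule) :
    conv g (conv a y) p = conv a (conv g y) p := by
  have hay : Summable fun z : dualModule × dualModule => ‖a z.1‖ * ‖y z.2‖ :=
    ha.mul_of_nonneg hy (fun _ => norm_nonneg _) (fun _ => norm_nonneg _)
  let e : dualModule × dualModule ≃ dualModule × dualModule :=
    { toFun := fun z => (z.1 - z.2, z.2)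
      invFun := fun z => (z.1 + z.2, z.2)
      left_inv := fun z => by simp
      right_inv := fun z => by simp }
  let e' : dualModule × dualModule ≃ dualModule × dualModule :=
    { toFun := fun z => (p - z.1, z.2)
      invFun := fun z => (p - z.1, z.2)
      left_inv := fun z => by simp
      right_inv := fun z => by simp }
  have h1 : Summable fun z : dualModule × dualModule => g (p - z.1) * (a (z.1 - z.2) * y z.2) := by
    refine Summable.of_norm_bounded ((e.summable_iff.2 hay).mul_left C) fun z => ?_
    rw [norm_mul, norm_mul]
    exact mul_le_mul_of_nonneg_right (hg _) (by positivity)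
  have h2 : Summable fun z : dualModule × dualModule => a (p - z.1) * (g (z.1 - z.2) * y z.2) := by
    refine Summable.of_norm_bounded ((e'.summable_iff.2 hay).mul_left C) fun z => ?_
    rw [norm_mul, norm_mul, mul_left_comm]
    exact mul_le_mul_of_nonneg_right (hg _) (by positivity)
  unfold conv
  simp_rw [← tsum_mul_left]
  rw [← h1.tsum_prod, ← h2.tsum_prod]
  -- For fixed r the involution q ↦ p + r - q exchanges p - q and q - r.
  let e'' : dualModule × dualModule ≃ dualModule × dualModule :=
    { toFun := fun z => (p + z.2 - z.1, z.2)
      invFun := fun z => (p + z.2 - z.1, z.2)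
      left_inv := fun z => by simp
      right_inv := fun z => by simp }
  rw [← e''.tsum_eq]
  refine tsum_congr fun z => ?_
  change g (p - (p + z.2 - z.1)) * (a (p + z.2 - z.1 - z.2) * y z.2) = _
  have r1 : p - (p + z.2 - z.1) = z.1 - z.2 := by abel
  have r2 : p + z.2 - z.1 - z.2 = p - z.1 := by abel
  rw [r1, r2]
  ring

/-! ### Eigensequences -/

/-- The eigenvalue equation `D v = k v` on the Fourier side, for the potential with Fourier
coefficients `a`, `b` and `v` with Fourier coefficients `x`, `y`. -/
structure IsEigenSeq (a b : dualModule → ℂ) (k : ℂ) (x y : dualModule → ℂ) : Prop where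
  left : ∀ p, (p - k) * x p + conv a y p = 0
  right : ∀ p, (p - k) * y p + conv b x p = 0

theorem exists_le_norm_sub {k : ℂ} (hk : k ∉ dualLattice) :
    ∃ c > 0, ∀ p : dualModule, c * (1 + ‖(p : ℂ)‖) ≤ ‖(p : ℂ) - k‖ := by
  obtain ⟨δ, hδ, h⟩ := exists_dist_dualModule_le hk
  -- From 1 + |p| ≤ |p - k| + (1 + |k|) and 1 ≤ |p - k| / δ.
  refine ⟨((1 + ‖k‖) / δ + 1)⁻¹, by positivity, fun p => ?_⟩
  rw [inv_mul_le_iff₀ (by positivity)]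
  have h1 : ‖(p : ℂ)‖ ≤ ‖(p : ℂ) - k‖ + ‖k‖ := by simpa using norm_add_le ((p : ℂ) - k) k
  have h2 : 1 + ‖k‖ ≤ (1 + ‖k‖) / δ * ‖(p : ℂ) - k‖ := by
    rw [div_mul_eq_mul_div, le_div_iff₀ hδ]
    exact mul_le_mul_of_nonneg_left (h p) (by positivity)
  linarith

/-- The elliptic gain: off Γ* the divisor p - k is at least of size 1 + |p|, up to a constant. -/
theorem exists_norm_mul_le_of_eq {k : ℂ} (hk : k ∉ dualLattice) {x y : dualModule → ℂ} {M : ℕ}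
    {C : ℝ}
    (hy : ∀ p, ‖y p‖ * (1 + ‖(p : ℂ)‖) ^ M ≤ C) (h : ∀ p : dualModule, (p - k) * x p + y p = 0) :
    ∃ C', ∀ p, ‖x p‖ * (1 + ‖(p : ℂ)‖) ^ (M + 1) ≤ C' := by
  obtain ⟨c, hc, hck⟩ := exists_le_norm_sub hk
  refine ⟨c⁻¹ * C, fun p => ?_⟩
  rw [← div_eq_inv_mul, le_div_iff₀ hc]
  refine le_trans ?_ (hy p)
  have h1 : ‖y p‖ = ‖(p : ℂ) - k‖ * ‖x p‖ := by
    rw [← norm_mul, ← norm_neg, ← eq_neg_of_add_eq_zero_left (h p)]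
  rw [h1]
  calc ‖x p‖ * (1 + ‖(p : ℂ)‖) ^ (M + 1) * c
      = (c * (1 + ‖(p : ℂ)‖)) * ‖x p‖ * (1 + ‖(p : ℂ)‖) ^ M := by ring
    _ ≤ _ := by gcongr; exact hck p

/-- Bootstrap: convolution with the potential keeps decay of order M and the equation raises it to M
+ 1. Mere boundedness starts the induction, so it also applies to sequences convolved with Green
coefficients. -/
theorem IsEigenSeq.rapidDecay {a b : dualModule → ℂ} (ha : RapidDecay a) (hb : RapidDecay b) {k : ℂ}
    (hk : k ∉ dualLattice) {x y : dualModule → ℂ} (h : IsEigenSeq a b k x y) {C : ℝ}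
    (hx : ∀ p, ‖x p‖ ≤ C) (hy : ∀ p, ‖y p‖ ≤ C) : RapidDecay x ∧ RapidDecay y := by
  have key : ∀ M : ℕ, (∃ C, ∀ p, ‖x p‖ * (1 + ‖(p : ℂ)‖) ^ M ≤ C) ∧
      (∃ C, ∀ p, ‖y p‖ * (1 + ‖(p : ℂ)‖) ^ M ≤ C) := by
    intro M
    induction M with
    | zero => exact ⟨⟨C, by simpa using hx⟩, ⟨C, by simpa using hy⟩⟩
    | succ M ih =>
      obtain ⟨⟨C1, h1⟩, ⟨C2, h2⟩⟩ := ih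
      obtain ⟨C3, h3⟩ := exists_norm_conv_mul_le ha M h2
      obtain ⟨C4, h4⟩ := exists_norm_conv_mul_le hb M h1
      exact ⟨exists_norm_mul_le_of_eq hk h3 h.left, exists_norm_mul_le_of_eq hk h4 h.right⟩
  exact ⟨fun M => (key M).1, fun M => (key M).2⟩

/-! ### Moving an eigenvalue with the Green function -/

/-- The Fourier coefficients of the Green function of `2 D_{z̄} - k` with pole at `z`, up to a
constant. -/
def greenCoeff (k z : ℂ) (p : dualModule) : ℂ := wave (-p) z / (p - k)

theorem exists_norm_greenCoeff_le {k : ℂ} (hk : k ∉ dualLattice) (z : ℂ) :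
    ∃ C, ∀ p, ‖greenCoeff k z p‖ ≤ C := by
  obtain ⟨δ, hδ, h⟩ := exists_dist_dualModule_le hk
  refine ⟨δ⁻¹, fun p => ?_⟩
  rw [greenCoeff, norm_div, norm_wave, one_div]
  exact inv_anti₀ hδ (h p)

theorem sub_ne_zero_of_not_mem {k : ℂ} (hk : k ∉ dualLattice) (p : dualModule) : (p : ℂ)
    - k ≠ 0 := by
  intro h
  rw [sub_eq_zero] at h
  exact hk (h ▸ (mem_dualLattice_iff_mem_dualModule p).2 p.2)

/-- Once the Green function is moved past the potential, (p - k - k') - (q - k) = p - q - k' cancels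
the denominator of `greenCoeff`. What remains is `wave (-p) z` times the value of the series at z:
the delta function, killed by the zero. -/
theorem green_eq {a x y : dualModule → ℂ} {k k' z : ℂ} (hk' : k' ∉ dualLattice)
    (ha : Summable fun p => ‖a p‖) (hx : Summable fun p => ‖x p‖) (hy : Summable fun p => ‖y p‖)
    (h : ∀ p : dualModule, (p - k) * x p + conv a y p = 0)
    (hz : ∑' p : dualModule, x p * wave p z = 0) (p : dualModule) :
    (p - (k + k')) * conv (greenCoeff k' z) x p + conv a (conv (greenCoeff k' z) y) p = 0 := by
  obtain ⟨C, hC⟩ := exists_norm_greenCoeff_le hk' z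
  have hax : ∀ p : dualModule, conv a y p = -((p - k) * x p) := fun p =>
    eq_neg_of_add_eq_zero_right (h p)
  have hay : Summable fun p => ‖conv a y p‖ := by
    have h2 : Summable fun z : dualModule × dualModule => ‖a z.1‖ * ‖y z.2‖ :=
      ha.mul_of_nonneg hy (fun _ => norm_nonneg _) (fun _ => norm_nonneg _)
    let e : dualModule × dualModule ≃ dualModule × dualModule :=
      { toFun := fun z => (z.1 - z.2, z.2)
        invFun := fun z => (z.1 + z.2, z.2)
        left_inv := fun z => by simp
        right_inv := fun z => by simp }
    have h3 : Summable fun z : dualModule × dualModule => ‖a (z.1 - z.2) * y z.2‖ := by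
      simp_rw [norm_mul]
      exact e.summable_iff.2 h2
    exact Summable.of_nonneg_of_le (fun _ => norm_nonneg _)
      (fun q => norm_tsum_le_tsum_norm (h3.prod_factor q)) h3.prod
  rw [← conv_conv hC ha hy]
  have s1 := (summable_conv_of_bounded_left hx hC p).of_norm
  have s2 := (summable_conv_of_bounded_left hay hC p).of_norm
  have e1 : conv (greenCoeff k' z) (conv a y) p =
      ∑' q, greenCoeff k' z (p - q) * conv a y q := rfl
  rw [conv, e1, ← tsum_mul_left, ← (s1.mul_left _).tsum_add s2]
  have e2 : ∀ q : dualModule, (p - (k + k')) * (greenCoeff k' z (p - q) * x q) +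
      greenCoeff k' z (p - q) * conv a y q = wave (-p) z * (x q * wave q z) := by
    intro q
    have hne := sub_ne_zero_of_not_mem hk' (p - q)
    have e3 : greenCoeff k' z (p - q) * (((p - q : dualModule) : ℂ) - k') = wave (-p)
        z * wave q z := by
      rw [greenCoeff, div_mul_cancel₀ _ hne, ← wave_add_left]
      congr 1
      push_cast
      ring
    rw [hax]
    push_cast at e3
    linear_combination (x q) * e3
  simp_rw [e2]
  rw [tsum_mul_left, hz, mul_zero]

/-- As k → 0 the term q = p of the convolution has size ‖x p‖ / ‖k‖, while the rest stays bounded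
because Γ* is discrete. -/
theorem exists_conv_greenCoeff_ne_zero {x : dualModule → ℂ} (hx : Summable fun p => ‖x p‖)
    {p : dualModule} (hp : x p ≠ 0) (z : ℂ) :
    ∃ ε > 0, ∀ k : ℂ, k ≠ 0 → ‖k‖ < ε → k ∉ dualLattice ∧ conv (greenCoeff k z) x p ≠ 0 := by
  obtain ⟨ρ, hρ, h⟩ := exists_norm_dualModule_le
  have hS : 0 ≤ ∑' q, ‖x q‖ := tsum_nonneg fun _ => norm_nonneg _
  have hxp : 0 < ‖x p‖ := norm_pos_iff.2 hp
  -- The bound ρ / 2 keeps the denominators with q ≠ p at least ρ / 2; the second bound lets the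
  -- term q = p outweigh the others, and the + 1 keeps its denominator positive.
  refine ⟨min (ρ / 2) (‖x p‖ / (2 / ρ * ∑' q, ‖x q‖ + 1)), by positivity, fun k hk0 hk => ?_⟩
  have hk1 : ‖k‖ < ρ / 2 := hk.trans_le (min_le_left _ _)
  have hk2 := hk.trans_le (min_le_right _ _)
  rw [lt_div_iff₀ (by positivity)] at hk2
  have hnk : 0 < ‖k‖ := norm_pos_iff.2 hk0
  have hkd : k ∉ dualLattice := by
    intro hmem
    have := h ⟨k, (mem_dualLattice_iff_mem_dualModule k).1 hmem⟩
      (fun e => hk0 (congrArg Subtype.val e))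
    change ρ ≤ ‖k‖ at this
    linarith
  refine ⟨hkd, fun h0 => ?_⟩
  obtain ⟨C, hC⟩ := exists_norm_greenCoeff_le hkd z
  classical
  have s1 := (summable_conv_of_bounded_left hx hC p).of_norm
  rw [conv, s1.tsum_eq_add_tsum_ite p] at h0
  have h2 : ‖∑' q, if q = p then 0 else greenCoeff k z (p - q) * x q‖ ≤ 2 / ρ * ∑' q, ‖x q‖ := by
    rw [← tsum_mul_left]
    have hb : ∀ q, ‖if q = p then 0 else greenCoeff k z (p - q) * x q‖ ≤ 2 / ρ * ‖x q‖ := by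
      intro q
      split_ifs with hq
      · simp; positivity
      · rw [norm_mul]
        refine mul_le_mul_of_nonneg_right ?_ (norm_nonneg _)
        rw [greenCoeff, norm_div, norm_wave, one_div, ← inv_div]
        refine inv_anti₀ (by positivity) ?_
        have h3 := h (p - q) (sub_ne_zero.2 (Ne.symm hq))
        have h4 := norm_sub_norm_le ((p - q : dualModule) : ℂ) k
        linarith
    exact (norm_tsum_le_tsum_norm (Summable.of_nonneg_of_le (fun _ => norm_nonneg _) hb
      (hx.mul_left _))).trans ((Summable.of_nonneg_of_le (fun _ => norm_nonneg _) hb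
      (hx.mul_left _)).tsum_le_tsum hb (hx.mul_left _))
  rw [← norm_neg, ← eq_neg_of_add_eq_zero_left h0, norm_mul, sub_self, greenCoeff, norm_div,
    norm_wave] at h2
  simp only [ZeroMemClass.coe_zero, zero_sub, norm_neg] at h2
  rw [div_mul_eq_mul_div, one_mul, div_le_iff₀ hnk] at h2
  nlinarith

/-! ### The classical operator `2 D_{z̄}` -/

/-- `f` is real differentiable at `z`, with `2 D_{z̄} f (z) = c`. -/
def HasDbarAt (f : ℂ → ℂ) (c z : ℂ) : Prop :=
  ∃ L : ℂ →L[ℝ] ℂ, HasFDerivAt f L z ∧ L 1 + Complex.I * L Complex.I = Complex.I * c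

theorem HasDbarAt.continuousAt {f : ℂ → ℂ} {c z : ℂ} (h : HasDbarAt f c z) : ContinuousAt f z :=
  h.choose_spec.1.continuousAt

theorem HasDbarAt.congr {f g : ℂ → ℂ} {c z : ℂ} (h : HasDbarAt f c z) (hfg : g =ᶠ[nhds z] f) :
    HasDbarAt g c z := by
  obtain ⟨L, hL, hc⟩ := h
  exact ⟨L, hL.congr_of_eventuallyEq hfg, hc⟩

theorem HasDbarAt.sub {f g : ℂ → ℂ} {c d z : ℂ} (hf : HasDbarAt f c z) (hg : HasDbarAt g d z) :
    HasDbarAt (fun z => f z - g z) (c - d) z := by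
  obtain ⟨L, hL, hc⟩ := hf
  obtain ⟨M, hM, hd⟩ := hg
  refine ⟨L - M, hL.sub hM, ?_⟩
  simp only [sub_apply]
  linear_combination hc - hd

theorem HasDbarAt.mul {f g : ℂ → ℂ} {c d z : ℂ} (hf : HasDbarAt f c z) (hg : HasDbarAt g d z) :
    HasDbarAt (fun z => f z * g z) (c * g z + f z * d) z := by
  obtain ⟨L, hL, hc⟩ := hf
  obtain ⟨M, hM, hd⟩ := hg
  refine ⟨_, hL.mul hM, ?_⟩
  simp only [add_apply, smul_apply, smul_eq_mul]
  linear_combination g z * hc + f z * hd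

theorem HasDbarAt.inv {f : ℂ → ℂ} {c z : ℂ} (hf : HasDbarAt f c z) (h0 : f z ≠ 0) :
    HasDbarAt (fun z => (f z)⁻¹) (-(f z ^ 2)⁻¹ * c) z := by
  obtain ⟨L, hL, hc⟩ := hf
  refine ⟨_, ((hasDerivAt_inv h0).hasFDerivAt.restrictScalars ℝ).comp z hL, ?_⟩
  simp
  linear_combination (-(f z ^ 2)⁻¹) * hc

/-- Multiplication by w is holomorphic, so only the conjugate of its derivative enters the chain
rule for ∂_{z̄}. -/
theorem HasDbarAt.comp_mul_left {f : ℂ → ℂ} {c w z : ℂ} (hf : HasDbarAt f c (w * z)) :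
    HasDbarAt (fun z => f (w * z)) (conj w * c) z := by
  obtain ⟨L, hL, hc⟩ := hf
  have h1 : HasFDerivAt (fun z : ℂ => w * z) (ContinuousLinearMap.mul ℝ ℂ w) z :=
    (ContinuousLinearMap.mul ℝ ℂ w).hasFDerivAt
  refine ⟨_, hL.comp z h1, ?_⟩
  have key : ∀ v : ℂ, L v = v.re * L 1 + v.im * L Complex.I := by
    intro v
    have : v = v.re • (1 : ℂ) + v.im • Complex.I := by
      simp
    conv_lhs => rw [this]
    rw [map_add, map_smul, map_smul, Complex.real_smul, Complex.real_smul]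
  simp only [ContinuousLinearMap.comp_apply, ContinuousLinearMap.mul_apply']
  rw [key (w * 1), key (w * Complex.I)]
  have hw : conj w = w.re - w.im * Complex.I := by
    apply Complex.ext <;> simp
  rw [hw]
  simp
  linear_combination ((w.re : ℂ) - w.im * Complex.I) * hc +
    (w.im : ℂ) * L Complex.I * Complex.I_sq

theorem hasDbarAt_wave (p z : ℂ) : HasDbarAt (wave p) (p * wave p z) z := by
  refine ⟨_, ((contDiff_wave p).differentiable (by simp) z).hasFDerivAt, ?_⟩
  rw [fderiv_wave_apply, fderiv_wave_apply]
  have e1 : pair p 1 = (p : ℂ).re := by simp [pair]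
  have e2 : pair p Complex.I = (p : ℂ).im := by simp [pair]
  rw [e1, e2]
  linear_combination (Complex.I * wave p z) * Complex.re_add_im p

/-- Bounded solutions of `2 D_{z̄} f = κ f` are multiples of a plane wave. -/
theorem exists_eq_const_mul_wave {f : ℂ → ℂ} {κ : ℂ} (hf : ∀ z, HasDbarAt f (κ * f z) z) {C : ℝ}
    (hC : ∀ z, ‖f z‖ ≤ C) : ∃ c, ∀ z, f z = c * wave κ z := by
  -- The opposite wave removes the zeroth-order term; the product is entire and bounded, so
  -- Liouville applies.
  have hg : ∀ z, HasDbarAt (fun z => f z * wave (-κ) z) 0 z := by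
    intro z
    convert (hf z).mul (hasDbarAt_wave (-κ) z) using 1
    ring
  have hd : Differentiable ℂ fun z => f z * wave (-κ) z := by
    intro z
    obtain ⟨L, hL, hc⟩ := hg z
    rw [differentiableAt_complex_iff_differentiableAt_real]
    refine ⟨hL.differentiableAt, ?_⟩
    rw [hL.fderiv, smul_eq_mul]
    linear_combination (-Complex.I) * hc + L Complex.I * Complex.I_sq
  obtain ⟨c, hc⟩ := hd.exists_const_forall_eq_of_bounded
    ((Metric.isBounded_iff_subset_closedBall 0).2 ⟨C, by
      rintro _ ⟨z, rfl⟩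
      rw [mem_closedBall_zero_iff, norm_mul, norm_wave, mul_one]
      exact hC z⟩)
  refine ⟨c, fun z => ?_⟩
  rw [← hc z, mul_assoc, ← wave_add_left, neg_add_cancel, wave_zero_left, mul_one]

theorem exists_norm_le_of_periodic {f : ℂ → ℂ} (hf : Continuous f)
    (h : ∀ z, ∀ γ ∈ Γ, f (z + γ) = f z) : ∃ C, ∀ z, ‖f z‖ ≤ C := by
  obtain ⟨C, hC⟩ := (isBounded_cell.isCompact_closure).exists_bound_of_continuousOn hf.continuousOn
  refine ⟨C, fun z => ?_⟩
  obtain ⟨w, hw, hwz⟩ := coe_surjOn_cell (Set.mem_univ (z : Torus))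
  have h1 : -w + z ∈ Γ := QuotientAddGroup.eq.1 hwz
  have h2 : z = w + (-w + z) := by ring
  rw [h2, h _ _ h1]
  exact hC w (subset_closure hw)

/-! ### Fourier series -/

/-- The sum of a Fourier series on `ℂ / Γ`. -/
def series (x : dualModule → ℂ) (z : ℂ) : ℂ := ∑' p : dualModule, x p * wave p z

theorem summable_mul_wave {x : dualModule → ℂ} (hx : Summable fun p => ‖x p‖) (z : ℂ) :
    Summable fun p : dualModule => ‖x p * wave p z‖ := by
  simpa only [norm_mul, norm_wave, mul_one] using hx

theorem series_add_gamma (x : dualModule → ℂ) (z : ℂ) {γ : ℂ} (hγ : γ ∈ Γ) :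
    series x (z + γ) = series x z := by
  unfold series
  refine tsum_congr fun p => ?_
  rw [wave_add_right, wave_gamma p hγ, mul_one]

theorem RapidDecay.mul_coe {x : dualModule → ℂ} (hx : RapidDecay x) :
    RapidDecay fun p : dualModule => (p : ℂ) * x p := by
  intro M
  obtain ⟨C, hC⟩ := hx (M + 1)
  refine ⟨C, fun p => le_trans ?_ (hC p)⟩
  rw [norm_mul, pow_succ']
  have : ‖(p : ℂ)‖ ≤ 1 + ‖(p : ℂ)‖ := by linarith
  calc ‖(p : ℂ)‖ * ‖x p‖ * (1 + ‖(p : ℂ)‖) ^ M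
      ≤ (1 + ‖(p : ℂ)‖) * ‖x p‖ * (1 + ‖(p : ℂ)‖) ^ M := by gcongr
    _ = _ := by ring

theorem hasDbarAt_series {x : dualModule → ℂ} (hx : RapidDecay x) (z : ℂ) :
    HasDbarAt (series x) (series (fun p => p * x p) z) z := by
  have hs := hx.mul_coe.summable
  have hb : ∀ (p : dualModule) (z : ℂ), ‖x p • fderiv ℝ (wave p) z‖ ≤ ‖(p : ℂ) * x p‖ := by
    intro p z
    rw [norm_smul, norm_mul, mul_comm]
    refine mul_le_mul_of_nonneg_right ?_ (norm_nonneg _)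
    refine ContinuousLinearMap.opNorm_le_bound _ (norm_nonneg _) fun v => ?_
    rw [fderiv_wave_apply, norm_mul, norm_mul, Complex.norm_I, one_mul, norm_wave, mul_one,
      Complex.norm_real]
    exact abs_pair_le _ _
  have hd := hasFDerivAt_tsum (𝕜 := ℝ) (f := fun (p : dualModule) z => x p * wave p z)
    (f' := fun (p : dualModule) z => x p • fderiv ℝ (wave p) z) hs
    (fun p z => ((contDiff_wave p).differentiable (by simp) z).hasFDerivAt.const_mul (x p)) hb
    (summable_mul_wave hx.summable 0).of_norm z
  refine ⟨_, hd, ?_⟩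
  have hsum : Summable fun p : dualModule => x p • fderiv ℝ (wave p) z :=
    Summable.of_norm_bounded hs fun p => hb p z
  have hap : ∀ v, (∑' p : dualModule, x p • fderiv ℝ (wave p) z) v =
      ∑' p : dualModule, x p * (Complex.I * pair p v * wave p z) := by
    intro v
    refine ((ContinuousLinearMap.apply ℝ ℂ v).map_tsum hsum).trans ?_
    refine tsum_congr fun p => ?_
    rw [← fderiv_wave_apply]
    rfl
  have hap' : ∀ v, Summable fun p : dualModule => x p * (Complex.I * pair p v * wave p z) := by
    intro v
    refine Summable.of_norm_bounded (hs.mul_right ‖v‖) fun p => ?_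
    rw [norm_mul, norm_mul, norm_mul, norm_mul, Complex.norm_I, one_mul, norm_wave, mul_one,
      Complex.norm_real, mul_comm ‖(p : ℂ)‖, mul_assoc]
    exact mul_le_mul_of_nonneg_left (abs_pair_le _ _) (norm_nonneg _)
  rw [hap, hap, series, ← tsum_mul_left, ← tsum_mul_left,
    ← (hap' 1).tsum_add ((hap' Complex.I).mul_left _)]
  refine tsum_congr fun p => ?_
  have e1 : pair p 1 = (p : ℂ).re := by simp [pair]
  have e2 : pair p Complex.I = (p : ℂ).im := by simp [pair]
  rw [e1, e2]
  linear_combination (Complex.I * x p * wave p z) * Complex.re_add_im (p : ℂ)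

theorem series_conv {a x : dualModule → ℂ} (ha : Summable fun p => ‖a p‖)
    (hx : Summable fun p => ‖x p‖) (z : ℂ) : series (conv a x) z = series a z * series x z := by
  have h1 : Summable fun w : dualModule × dualModule => (a w.1 * wave w.1 z) * (x w.2 * wave w.2 z)
      :=
    ((summable_mul_wave ha z).mul_of_nonneg (summable_mul_wave hx z) (fun _ => norm_nonneg _)
      (fun _ => norm_nonneg _)).of_norm_bounded (fun w => (norm_mul _ _).le)
  let e : dualModule × dualModule ≃ dualModule × dualModule :=
    { toFun := fun w => (w.1 - w.2, w.2)
      invFun := fun w => (w.1 + w.2, w.2)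
      left_inv := fun w => by simp
      right_inv := fun w => by simp }
  have h2 := e.summable_iff.2 h1
  unfold series
  rw [tsum_mul_tsum_of_summable_norm (summable_mul_wave ha z) (summable_mul_wave hx z),
    ← e.tsum_eq]
  refine Eq.trans ?_ h2.tsum_prod.symm
  refine tsum_congr fun p => ?_
  rw [conv, ← tsum_mul_right]
  refine tsum_congr fun q => ?_
  change _ = (a (p - q) * wave (p - q : dualModule) z) * (x q * wave q z)
  have : wave p z = wave (p - q : dualModule) z * wave q z := by
    rw [← wave_add_left]; simp
  rw [this]
  ring

/-- Returns from coefficients to a pointwise equation for smooth functions, where zeros make sense.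
-/
theorem hasDbarAt_of_eq {a x y : dualModule → ℂ} {k : ℂ} (ha : RapidDecay a) (hx : RapidDecay x)
    (hy : RapidDecay y) (h : ∀ p : dualModule, (p - k) * x p + conv a y p = 0) (z : ℂ) :
    HasDbarAt (series x) (k * series x z - series a z * series y z) z := by
  have h1 := hasDbarAt_series hx z
  have s1 : Summable fun p : dualModule => x p * wave p z :=
      (summable_mul_wave hx.summable z).of_norm
  have s2 : Summable fun p : dualModule => (p : ℂ) * x p * wave p z :=
    (summable_mul_wave hx.mul_coe.summable z).of_norm
  have e : series (fun p => p * x p) z = k * series x z - series a z * series y z := by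
    rw [← series_conv ha.summable hy.summable, series, series, series, ← tsum_mul_left,
        eq_sub_iff_add_eq]
    have e1 : ∀ p : dualModule, conv a y p * wave p z = k * (x p * wave p z) -
        (p : ℂ) * x p * wave p z := fun p => by
      linear_combination (wave p z) * h p
    simp_rw [e1]
    rw [(s1.mul_left k).tsum_sub s2]
    ring
  rwa [e] at h1

/-! ### Eigenfunctions have zeros -/

theorem ω_cube : ω ^ 3 = 1 := by
  linear_combination (ω - 1) * ω_sq

theorem mem_dualLattice_of_const_mul_wave {f : ℂ → ℂ} {c κ z₀ : ℂ}
    (hf : ∀ z, ∀ γ ∈ Γ, f (z + γ) = f z) (hc : ∀ z, f z = c * wave κ z) (h0 : f z₀ ≠ 0) :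
    κ ∈ dualLattice := by
  rw [mem_dualLattice_iff_wave]
  intro γ hγ
  have h1 := hf z₀ γ hγ
  rw [hc, wave_add_right, ← mul_assoc, ← hc] at h1
  exact mul_left_cancel₀ h0 (h1.trans (mul_one _).symm)

/-- Two further rotations turn -ωk into -k, and Γ* is stable under rotation and sign. -/
theorem neg_ω_mul_not_mem {k : ℂ} (hk : k ∉ dualLattice) : -ω * k ∉ dualLattice := by
  intro h
  apply hk
  have h1 := ω_mul_mem_dualLattice (ω_mul_mem_dualLattice h)
  have h2 : ω * (ω * (-ω * k)) = -k := by linear_combination (-k) * ω_cube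
  rw [h2, mem_dualLattice_iff_mem_dualModule] at h1
  rw [mem_dualLattice_iff_mem_dualModule]
  simpa using neg_mem h1

/-- Otherwise the rotated eigenfunction would be a scalar multiple f of the original, with f a plane
wave; its values at the fixed points of the rotation are incompatible with k ∉ Γ*. -/
theorem IsEigenSeq.exists_zero {a b x y : dualModule → ℂ} {k : ℂ} (h : IsEigenSeq a b k x y)
    (hk : k ∉ dualLattice) (ha : RapidDecay a) (hb : RapidDecay b) (hx : RapidDecay x)
    (hy : RapidDecay y) (hωa : ∀ z, series a (ω * z) = ω * series a z)
    (hωb : ∀ z, series b (ω * z) = ω * series b z) : ∃ z, series x z = 0 ∧ series y z = 0 := by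
  by_contra! hne
  set X := series x
  set Y := series y
  have hX : ∀ z, HasDbarAt X (k * X z - series a z * Y z) z := hasDbarAt_of_eq ha hx hy h.left
  have hY : ∀ z, HasDbarAt Y (k * Y z - series b z * X z) z := hasDbarAt_of_eq hb hy hx h.right
  have hX' : ∀ z, HasDbarAt (fun z => X (ω * z))
      (conj ω * (k * X (ω * z) - series a (ω * z) * Y (ω * z))) z := fun z =>
    (hX (ω * z)).comp_mul_left
  have hY' : ∀ z, HasDbarAt (fun z => Y (ω * z))
      (conj ω * (k * Y (ω * z) - series b (ω * z) * X (ω * z))) z := fun z =>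
    (hY (ω * z)).comp_mul_left
  have pX : ∀ z, ∀ γ ∈ Γ, X (z + γ) = X z := fun z γ hγ => series_add_gamma x z hγ
  have pY : ∀ z, ∀ γ ∈ Γ, Y (z + γ) = Y z := fun z γ hγ => series_add_gamma y z hγ
  have pX' : ∀ z, ∀ γ ∈ Γ, X (ω * (z + γ)) = X (ω * z) := fun z γ hγ => by
    rw [mul_add, pX _ _ (ω_mul_mem_Γ hγ)]
  have pY' : ∀ z, ∀ γ ∈ Γ, Y (ω * (z + γ)) = Y (ω * z) := fun z γ hγ => by
    rw [mul_add, pY _ _ (ω_mul_mem_Γ hγ)]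
  -- the Wronskian of `(X, Y)` and its rotation vanishes
  have hW : ∀ z, X z * Y (ω * z) - Y z * X (ω * z) = 0 := by
    have hd : ∀ z, HasDbarAt (fun z => X z * Y (ω * z) - Y z * X (ω * z))
        ((-ω * k) * (X z * Y (ω * z) - Y z * X (ω * z))) z := by
      intro z
      convert ((hX z).mul (hY' z)).sub ((hY z).mul (hX' z)) using 1
      -- The wave vectors add up to k + ω̄ k = -ωk, and the potential terms cancel because ω̄ ω = 1.
      rw [hωa, hωb, conj_ω]
      linear_combination (-k * (X z * Y (ω * z) - Y z * X (ω * z))) * ω_sq +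
        (series b z * X z * X (ω * z) - series a z * Y z * Y (ω * z)) * ω_cube
    have hp : ∀ z, ∀ γ ∈ Γ, X (z + γ) * Y (ω * (z + γ)) - Y (z + γ) * X (ω * (z + γ)) =
        X z * Y (ω * z) - Y z * X (ω * z) := fun z γ hγ => by
      rw [pX z γ hγ, pY z γ hγ, pX' z γ hγ, pY' z γ hγ]
    obtain ⟨C, hC⟩ := exists_norm_le_of_periodic
      (continuous_iff_continuousAt.2 fun z => (hd z).continuousAt) hp
    obtain ⟨c, hc⟩ := exists_eq_const_mul_wave hd hC
    intro z
    by_contra h0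
    exact neg_ω_mul_not_mem hk (mem_dualLattice_of_const_mul_wave hp hc h0)
  -- the quotient of the rotation by `(X, Y)`
  classical
  -- Either component defines the quotient where it is nonzero; the vanishing Wronskian makes the
  -- two agree.
  let f : ℂ → ℂ := fun z => if X z = 0 then Y (ω * z) * (Y z)⁻¹ else X (ω * z) * (X z)⁻¹
  have fX : ∀ z, X (ω * z) = f z * X z := by
    intro z
    by_cases h0 : X z = 0
    · have hYz := hne z h0
      have := hW z
      rw [h0, zero_mul, zero_sub, neg_eq_zero, mul_eq_zero] at this
      rw [h0, mul_zero]
      exact this.resolve_left hYz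
    · simp only [f, if_neg h0]
      rw [mul_assoc, inv_mul_cancel₀ h0, mul_one]
  have fY : ∀ z, Y (ω * z) = f z * Y z := by
    intro z
    by_cases h0 : X z = 0
    · simp only [f, if_pos h0]
      rw [mul_assoc, inv_mul_cancel₀ (hne z h0), mul_one]
    · have := hW z
      rw [fX z] at this
      apply mul_left_cancel₀ h0
      linear_combination this
  have hf : ∀ z, HasDbarAt f ((conj ω - 1) * k * f z) z := by
    intro z
    by_cases h0 : X z = 0
    · have hYz := hne z h0
      have hev : f =ᶠ[nhds z] fun z => Y (ω * z) * (Y z)⁻¹ := by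
        filter_upwards [(hY z).continuousAt.eventually_ne hYz] with w hw
        rw [fY w, mul_assoc, mul_inv_cancel₀ hw, mul_one]
      refine HasDbarAt.congr ?_ hev
      convert (hY' z).mul ((hY z).inv hYz) using 1
      rw [hωb, fY z, fX z, h0, conj_ω]
      field_simp
      ring
    · have hev : f =ᶠ[nhds z] fun z => X (ω * z) * (X z)⁻¹ := by
        filter_upwards [(hX z).continuousAt.eventually_ne h0] with w hw
        rw [fX w, mul_assoc, mul_inv_cancel₀ hw, mul_one]
      refine HasDbarAt.congr ?_ hev
      convert (hX' z).mul ((hX z).inv h0) using 1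
      rw [hωa, fY z, fX z, conj_ω]
      field_simp
      linear_combination (series a z * Y z * f z) * ω_cube
  have pf : ∀ z, ∀ γ ∈ Γ, f (z + γ) = f z := by
    intro z γ hγ
    simp only [f]
    rw [pX z γ hγ, pY z γ hγ, pX' z γ hγ, pY' z γ hγ]
  obtain ⟨C, hC⟩ := exists_norm_le_of_periodic
    (continuous_iff_continuousAt.2 fun z => (hf z).continuousAt) pf
  obtain ⟨c, hc⟩ := exists_eq_const_mul_wave hf hC
  -- Applies where ωz ≡ z modulo Γ: first at 0, then at (ω - 1)⁻¹ γ.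
  have fixed : ∀ z, X (ω * z) = X z → Y (ω * z) = Y z → f z = 1 := by
    intro z h1 h2
    rw [fX z] at h1
    rw [fY z] at h2
    by_cases h0 : X z = 0
    · exact mul_right_cancel₀ (hne z h0) (h2.trans (one_mul _).symm)
    · exact mul_right_cancel₀ h0 (h1.trans (one_mul _).symm)
  have c1 : c = 1 := by
    have h1 := fixed 0 (by rw [mul_zero]) (by rw [mul_zero])
    rw [hc, wave_zero_right, mul_one] at h1
    exact h1
  apply hk
  rw [mem_dualLattice_iff_wave]
  intro γ hγ
  have hω1 : ω - 1 ≠ 0 := sub_ne_zero.2 ω_ne_one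
  have e1 : ω * ((ω - 1)⁻¹ * γ) = (ω - 1)⁻¹ * γ + γ := by
    field_simp
    ring
  have h1 := fixed ((ω - 1)⁻¹ * γ) (by rw [e1, pX _ _ hγ]) (by rw [e1, pY _ _ hγ])
  rw [hc, c1, one_mul, wave, pair_mul_left] at h1
  rw [wave, ← h1]
  congr 4
  -- Moving ω̄ - 1 across the pairing gives ω - 1, which cancels the inverse and leaves the pairing
  -- of k with γ.
  rw [map_sub, Complex.conj_conj, map_one, ← mul_assoc, mul_inv_cancel₀ hω1, one_mul]

/-! ### Resolvents of operators with a domain -/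

section Abstract

variable {E : Type*} [NormedAddCommGroup E] [NormedSpace ℂ E]

/-- `R` is the resolvent of `A` at `z`. -/
structure IsResolvent (A : E →ₗ.[ℂ] E) (z : ℂ) (R : E →L[ℂ] E) : Prop where
  mem : ∀ f, R f ∈ A.domain
  apply : ∀ f, A ⟨R f, mem f⟩ - z • R f = f
  apply_sub : ∀ u : A.domain, R (A u - z • (u : E)) = u

theorem mem_resolventSet_iff {A : E →ₗ.[ℂ] E} {z : ℂ} :
    z ∈ resolventSet A ↔ ∃ R, IsResolvent A z R :=
  ⟨fun ⟨R, h1, h2⟩ => ⟨R, fun f => (h1 f).1, fun f => (h1 f).2, h2⟩,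
    fun ⟨R, h⟩ => ⟨R, fun f => ⟨h.mem f, h.apply f⟩, h.apply_sub⟩⟩

theorem mem_Spec_of_eigenvector {A : E →ₗ.[ℂ] E} {z : ℂ} (u : A.domain) (hu : (u : E) ≠ 0)
    (h : A u = z • (u : E)) : z ∈ Spec A := by
  intro hz
  obtain ⟨R, hR⟩ := mem_resolventSet_iff.1 hz
  apply hu
  rw [← hR.apply_sub u, h, sub_self, map_zero]

theorem Spec_eq_spectrum {A : E →ₗ.[ℂ] E} {S : E →L[ℂ] E} (hdom : A.domain = ⊤)
    (hA : ∀ u : A.domain, A u = S u) : Spec A = spectrum ℂ S := by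
  ext z
  rw [Spec, Set.mem_compl_iff, spectrum.mem_iff, not_iff_not, mem_resolventSet_iff,
      ← IsUnit.neg_iff,
    neg_sub]
  have happ : ∀ u, (S - algebraMap ℂ (E →L[ℂ] E) z) u = S u - z • u := fun u => by
    simp [Algebra.algebraMap_eq_smul_one]
  constructor
  · rintro ⟨R, hR⟩
    refine ⟨⟨_, R, ?_, ?_⟩, rfl⟩
    · ext f
      have := hR.apply f
      rw [hA] at this
      change (S - algebraMap ℂ (E →L[ℂ] E) z) (R f) = f
      rw [happ]
      exact this
    · ext f
      have := hR.apply_sub ⟨f, by rw [hdom]; trivial⟩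
      rw [hA] at this
      change R ((S - algebraMap ℂ (E →L[ℂ] E) z) f) = f
      rw [happ]
      exact this
  · rintro ⟨⟨_, R, h1, h2⟩, rfl⟩
    refine ⟨R, fun f => by rw [hdom]; trivial, fun f => ?_, fun u => ?_⟩
    · have h : (S - algebraMap ℂ (E →L[ℂ] E) z) (R f) = f :=
        congrArg (fun S : E →L[ℂ] E => S f) h1
      rw [happ] at h
      rw [hA]
      exact h
    · have h : R ((S - algebraMap ℂ (E →L[ℂ] E) z) u) = u :=
        congrArg (fun S : E →L[ℂ] E => S u) h2
      rw [happ] at h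
      rw [hA]
      exact h

/-- Neumann series for the factorisation A - w = (1 - (w - z) R)(A - z). -/
theorem isOpen_resolventSet [CompleteSpace E] (A : E →ₗ.[ℂ] E) : IsOpen (resolventSet A) := by
  rw [Metric.isOpen_iff]
  intro z hz
  obtain ⟨R, hR⟩ := mem_resolventSet_iff.1 hz
  refine ⟨(‖R‖ + 1)⁻¹, by positivity, fun w hw => ?_⟩
  rw [mem_ball_iff_norm] at hw
  have hlt : ‖(w - z) • R‖ < 1 := by
    rw [norm_smul]
    calc ‖w - z‖ * ‖R‖ ≤ (‖R‖ + 1)⁻¹ * ‖R‖ := by gcongr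
      _ < 1 := by
        rw [inv_mul_lt_iff₀ (by positivity)]
        linarith
  obtain ⟨⟨S, W, h1, h2⟩, hS⟩ := isUnit_one_sub_of_norm_lt_one hlt
  simp only at hS
  subst hS
  have h1' : ∀ f, W f - (w - z) • R (W f) = f := fun f => congrArg (fun S : E →L[ℂ] E => S f) h1
  have h2' : ∀ f, W (f - (w - z) • R f) = f := fun f => congrArg (fun S : E →L[ℂ] E => S f) h2
  refine mem_resolventSet_iff.2 ⟨R * W, fun f => hR.mem _, fun f => ?_, fun u => ?_⟩
  · have e := hR.apply (W f)
    rw [sub_eq_iff_eq_add] at e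
    change A ⟨R (W f), _⟩ - w • R (W f) = f
    rw [e, add_sub_assoc, ← sub_smul, ← neg_sub w z, neg_smul, ← sub_eq_add_neg, h1']
  · change R (W (A u - w • (u : E))) = u
    have e : A u - w • (u : E) = (A u - z • (u : E)) - (w - z) • R (A u - z • (u : E)) := by
      rw [hR.apply_sub, sub_sub, ← add_smul, add_sub_cancel]
    rw [e, h2', hR.apply_sub]

/-- The resolvent of `A` at `z'` factors through the one at `z`. -/
theorem IsResolvent.exists_unit_mul {A : E →ₗ.[ℂ] E} {z z' : ℂ} {R R' : E →L[ℂ] E}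
    (h : IsResolvent A z R) (h' : IsResolvent A z' R') : ∃ Q : (E →L[ℂ] E)ˣ, R' = Q * R := by
  -- The resolvent identity; applied both ways it shows that 1 + (z' - z) R' and 1 + (z - z') R are
  -- inverse to each other.
  have key : ∀ {z z' : ℂ} {R R' : E →L[ℂ] E}, IsResolvent A z R → IsResolvent A z' R' →
      R' = R + (z' - z) • (R' * R) := by
    intro z z' R R' h h'
    ext f
    have e := h'.apply_sub ⟨R f, h.mem f⟩
    have e2 := h.apply f
    rw [sub_eq_iff_eq_add] at e2
    rw [e2, add_sub_assoc, ← sub_smul, map_add, map_smul] at e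
    change R' f = R f + (z' - z) • R' (R f)
    change R' f + (z - z') • R' (R f) = R f at e
    rw [← neg_sub z z', neg_smul, ← sub_eq_add_neg]
    exact eq_sub_of_add_eq e
  have k1 := key h h'
  have k2 := key h' h
  refine ⟨⟨1 + (z' - z) • R', 1 + (z - z') • R, ?_, ?_⟩, ?_⟩
  · ext f
    have e : R' f = R f + (z' - z) • R' (R f) := congrArg (fun S : E →L[ℂ] E => S f) k1
    change (f + (z - z') • R f) + (z' - z) • R' (f + (z - z') • R f) = f
    rw [map_add, map_smul]
    linear_combination (norm := module) (z' - z) • e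
  · ext f
    have e : R f = R' f + (z - z') • R (R' f) := congrArg (fun S : E →L[ℂ] E => S f) k2
    change (f + (z' - z) • R' f) + (z - z') • R (f + (z' - z) • R' f) = f
    rw [map_add, map_smul]
    linear_combination (norm := module) (z - z') • e
  · rw [add_mul, one_mul, smul_mul_assoc]
    exact k1

/-- Fredholm alternative for B - z = (A - z)(1 + R V): it is invertible unless -1 is an eigenvalue
of R V. Such eigenvectors lie in the range of R, hence in the domain. -/
theorem IsResolvent.mem_Spec_add_iff [CompleteSpace E] {A B : E →ₗ.[ℂ] E} {V R : E →L[ℂ] E} {z : ℂ}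
    (hR : IsResolvent A z R) (hdom : B.domain = A.domain)
    (hB : ∀ (u : E) (h : u ∈ B.domain) (h' : u ∈ A.domain), B ⟨u, h⟩ = A ⟨u, h'⟩ + V u)
    (hc : IsCompactOperator (R * V)) : z ∈ Spec B ↔ ∃ u, u ≠ 0 ∧ R (V u) = -u := by
  constructor
  · intro hz
    rcases hc.hasEigenvalue_or_mem_resolventSet (μ := -1) (by simp) with h | h
    · obtain ⟨u, hu⟩ := h.exists_hasEigenvector
      refine ⟨u, hu.2, ?_⟩
      have := hu.apply_eq_smul
      rw [neg_one_smul] at this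
      exact this
    · exfalso
      apply hz
      rw [spectrum.mem_resolventSet_iff, ← IsUnit.neg_iff, neg_sub, map_neg, map_one,
        sub_neg_eq_add] at h
      obtain ⟨⟨S, W, h1, h2⟩, hS⟩ := h
      simp only at hS
      subst hS
      have h1' : ∀ f, R (V (W f)) + W f = f := fun f => congrArg (fun S : E →L[ℂ] E => S f) h1
      have h2' : ∀ f, W (R (V f) + f) = f := fun f => congrArg (fun S : E →L[ℂ] E => S f) h2
      -- Exhibits W R f in the range of R, hence in the domain of A.
      have e : ∀ f, W (R f) = R (f - V (W (R f))) := fun f => by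
        rw [map_sub]
        exact eq_sub_of_add_eq' (h1' (R f))
      have hm : ∀ f, W (R f) ∈ A.domain := fun f => by
        rw [e]
        exact hR.mem _
      refine mem_resolventSet_iff.2 ⟨W * R, fun f => by rw [hdom]; exact hm f, fun f => ?_,
          fun u => ?_⟩
      · have hmB : W (R f) ∈ B.domain := by rw [hdom]; exact hm f
        change B ⟨W (R f), hmB⟩ - z • W (R f) = f
        rw [hB _ hmB (hm f)]
        have e2 := hR.apply (f - V (W (R f)))
        simp only [← e] at e2
        rw [add_sub_right_comm, e2, sub_add_cancel]
      · have hu : (u : E) ∈ A.domain := by rw [← hdom]; exact u.2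
        change W (R (B u - z • (u : E))) = u
        rw [hB u u.2 hu, add_sub_right_comm, map_add,
          hR.apply_sub ⟨u, hu⟩, add_comm, h2']
  · rintro ⟨u, hu, h⟩
    have e : u = R (-V u) := by rw [map_neg, h, neg_neg]
    have hm : u ∈ A.domain := by rw [e]; exact hR.mem _
    refine mem_Spec_of_eigenvector ⟨u, by rw [hdom]; exact hm⟩ hu ?_
    rw [hB u _ hm]
    have e2 := hR.apply (-V u)
    simp only [← e] at e2
    rw [sub_eq_iff_eq_add] at e2
    rw [e2]
    simp

end Abstract

section Adjoint

variable {E : Type*} [NormedAddCommGroup E] [InnerProductSpace ℂ E] [CompleteSpace E]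

/-- The inverse of the block operator is [[0, R], [R*, 0]] with R the resolvent of A at p;
conversely R is the upper right corner of that inverse. -/
theorem zero_mem_resolventSet_block_iff {A : E →ₗ.[ℂ] E} (hA : Dense (A.domain : Set E)) (p : ℂ) :
    0 ∈ resolventSet (blockOp 0 (A.adjoint - scalarOp E (conj p)) (A - scalarOp E p) 0) ↔
      p ∈ resolventSet A := by
  set B := blockOp 0 (A.adjoint - scalarOp E (conj p)) (A - scalarOp E p) 0 with hB
  have hBapp : ∀ w : B.domain, B w = WithLp.toLp 2
      ((A.adjoint ⟨w.1.snd, w.2.2.1.1⟩ - conj p • w.1.snd),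
        (A ⟨w.1.fst, w.2.1.2.1⟩ - p • w.1.fst)) := by
    intro w
    refine WithLp.ofLp_injective 2 (Prod.ext ?_ ?_)
    · exact zero_add _
    · exact add_zero _
  let P := WithLp.prodContinuousLinearEquiv 2 ℂ E E
  rw [mem_resolventSet_iff, mem_resolventSet_iff]
  constructor
  · rintro ⟨R, hR⟩
    refine ⟨(ContinuousLinearMap.fst ℂ E E).comp ((P : _ →L[ℂ] E × E).comp (R.comp
      ((P.symm : E × E →L[ℂ] _).comp (ContinuousLinearMap.inr ℂ E E)))), fun f => ?_, fun f => ?_,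
      fun u => ?_⟩
    · exact (hR.mem (WithLp.toLp 2 (0, f))).1.2.1
    · have := hR.apply (WithLp.toLp 2 (0, f))
      rw [zero_smul, sub_zero, hBapp] at this
      exact congrArg (fun w => (WithLp.ofLp w).2) this
    · have hm : WithLp.toLp 2 ((u : E), (0 : E)) ∈ B.domain :=
        ⟨⟨trivial, u.2, trivial⟩, ⟨A.adjoint.domain.zero_mem, trivial⟩, trivial⟩
      have hval : B ⟨_, hm⟩ = WithLp.toLp 2 ((0 : E), A u - p • (u : E)) := by
        rw [hBapp]
        refine WithLp.ofLp_injective 2 (Prod.ext ?_ rfl)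
        have e : A.adjoint ⟨0, A.adjoint.domain.zero_mem⟩ = 0 := A.adjoint.map_zero
        change A.adjoint ⟨0, A.adjoint.domain.zero_mem⟩ - conj p • (0 : E) = 0
        rw [e, smul_zero, sub_zero]
      have := hR.apply_sub ⟨_, hm⟩
      rw [zero_smul, sub_zero, hval] at this
      exact congrArg (fun w => (WithLp.ofLp w).1) this
  · rintro ⟨R, hR⟩
    -- This places R* f in the domain of A*, with A* R* f = f + p̄ R* f.
    have hadj : ∀ f, ∀ x : A.domain,
        inner ℂ (f + conj p • R.adjoint f) (x : E) = inner ℂ (R.adjoint f) (A x) := by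
      intro f x
      have e := hR.apply_sub x
      rw [map_sub, map_smul, sub_eq_iff_eq_add] at e
      rw [inner_add_left, inner_smul_left, Complex.conj_conj,
          ContinuousLinearMap.adjoint_inner_left,
        ContinuousLinearMap.adjoint_inner_left, e, inner_add_right, inner_smul_right]
    have hm : ∀ f, R.adjoint f ∈ A.adjoint.domain := fun f =>
      LinearPMap.mem_adjoint_domain_of_exists _ ⟨_, hadj f⟩
    refine ⟨(P.symm : E × E →L[ℂ] _).comp (((R.comp (ContinuousLinearMap.snd ℂ E E)).prod
      (R.adjoint.comp (ContinuousLinearMap.fst ℂ E E))).comp (P : _ →L[ℂ] E × E)), fun f => ?_,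
      fun f => ?_, fun w => ?_⟩
    · exact ⟨⟨trivial, hR.mem _, trivial⟩, ⟨hm _, trivial⟩, trivial⟩
    · rw [zero_smul, sub_zero, hBapp]
      refine WithLp.ofLp_injective 2 (Prod.ext ?_ ?_)
      · change A.adjoint ⟨R.adjoint f.fst, hm _⟩ - conj p • R.adjoint f.fst = f.fst
        rw [LinearPMap.adjoint_apply_eq hA _ (hadj f.fst), add_sub_cancel_right]
      · exact hR.apply f.snd
    · rw [zero_smul, sub_zero, hBapp]
      refine WithLp.ofLp_injective 2 (Prod.ext ?_ ?_)
      · exact hR.apply_sub ⟨w.1.fst, w.2.1.2.1⟩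
      · change R.adjoint (A.adjoint ⟨w.1.snd, w.2.2.1.1⟩ - conj p • w.1.snd) = w.1.snd
        refine ext_inner_right ℂ fun g => ?_
        rw [ContinuousLinearMap.adjoint_inner_left, inner_sub_left, inner_smul_left,
          Complex.conj_conj]
        have e := LinearPMap.adjoint_isFormalAdjoint hA ⟨w.1.snd, w.2.2.1.1⟩ ⟨R g, hR.mem g⟩
        simp only at e
        rw [e, ← inner_smul_right, ← inner_sub_right, hR.apply]

end Adjoint

/-! ### Fourier multipliers -/

theorem norm_le_of_norm_coeff_le {u w : L2} {C : ℝ} (hC : 0 ≤ C)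
    (h : ∀ p, ‖coeff w p‖ ≤ C * ‖coeff u p‖) : ‖w‖ ≤ C * ‖u‖ := by
  refine le_of_sq_le_sq ?_ (by positivity)
  rw [mul_pow, norm_sq_eq, norm_sq_eq, mul_left_comm]
  refine mul_le_mul_of_nonneg_left ?_ vol_pos.le
  rw [← tsum_mul_left]
  refine (summable_norm_sq_coeff w).tsum_le_tsum (fun p => ?_)
      ((summable_norm_sq_coeff u).mul_left _)
  rw [← mul_pow]
  gcongr
  exact h p

/-- The `p`-th Fourier coefficient as a continuous functional on `L²`. -/
def coeffL (p : dualModule) : L2 →L[ℂ] ℂ := (√vol : ℂ)⁻¹ • innerSL ℂ (charBasis p)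

theorem coeffL_apply (p : dualModule) (u : L2) : coeffL p u = coeff u p := by
  rw [coeff_eq, charBasis.repr_apply_apply]
  rfl

theorem exists_multiplier {m : dualModule → ℂ} {C : ℝ} (hm : ∀ p, ‖m p‖ ≤ C) :
    ∃ T : L2 →L[ℂ] L2, ∀ u p, coeff (T u) p = m p * coeff u p := by
  have hC : 0 ≤ C := (norm_nonneg _).trans (hm 0)
  have h : ∀ u : L2, ∃ w : L2, ∀ p, coeff w p = m p * coeff u p := fun u => by
    refine exists_coeff_eq ?_
    refine memℓp_of_norm_le ((memℓp_coeff u).const_smul (C : ℂ)) fun p => ?_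
    rw [norm_mul, Pi.smul_apply, norm_smul, Complex.norm_real, Real.norm_of_nonneg hC]
    exact mul_le_mul_of_nonneg_right (hm p) (norm_nonneg _)
  choose T hT using h
  refine ⟨LinearMap.mkContinuous
    { toFun := T
      map_add' := fun u v => coeff_ext fun p => by
        rw [hT, coeff_add, coeff_add, hT, hT, mul_add]
      map_smul' := fun c u => coeff_ext fun p => by
        rw [hT, RingHom.id_apply, coeff_smul, coeff_smul, hT, mul_left_comm] } C fun u => ?_, hT⟩
  refine norm_le_of_norm_coeff_le hC fun p => ?_
  change ‖coeff (T u) p‖ ≤ _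
  rw [hT, norm_mul]
  exact mul_le_mul_of_nonneg_right (hm p) (norm_nonneg _)

/-- Truncations to finitely many modes have finite rank, and they converge in norm because m tends
to 0. -/
theorem isCompactOperator_of_multiplier {m : dualModule → ℂ}
    (hm : Filter.Tendsto m Filter.cofinite (nhds 0))
    {T : L2 →L[ℂ] L2} (hT : ∀ u p, coeff (T u) p = m p * coeff u p) : IsCompactOperator T := by
  classical
  let F : Finset dualModule → L2 →L[ℂ] L2 := fun s =>
    ∑ p ∈ s, m p • (ContinuousLinearMap.toSpanSingleton ℂ (charLp p)).comp (coeffL p)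
  have hF : ∀ s u q, coeff (F s u) q = if q ∈ s then m q * coeff u q else 0 := by
    intro s u q
    have e : F s u = ∑ p ∈ s, m p • coeff u p • charLp p := by
      simp only [F, sum_apply]
      refine Finset.sum_congr rfl fun p _ => ?_
      rw [← coeffL_apply]
      rfl
    rw [e, ← coeffL_apply, map_sum]
    simp_rw [map_smul, coeffL_apply, coeff_charLp, smul_eq_mul, mul_ite, mul_one, mul_zero]
    rw [Finset.sum_ite_eq]
  have hcomp : ∀ s, IsCompactOperator (F s) := by
    intro s
    refine (compactOperator (RingHom.id ℂ) L2 L2).sum_mem fun p _ => ?_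
    refine Submodule.smul_mem _ _ ?_
    have h1 : IsCompactOperator (ContinuousLinearMap.toSpanSingleton ℂ (charLp p)) :=
      isCompactOperator_of_locallyCompactSpace_rng (ContinuousLinearMap.toSpanSingleton ℂ (charLp
          p))
    exact h1.comp_clm (coeffL p)
  refine isCompactOperator_of_tendsto (F := F) (l := Filter.atTop)
      ?_ (Filter.Eventually.of_forall hcomp)
  rw [Metric.tendsto_nhds]
  intro ε hε
  have hfin : {p | ¬ ‖m p‖ < ε / 2}.Finite := by
    have := (Metric.tendsto_nhds.1 hm) (ε / 2) (by positivity)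
    simpa only [dist_zero_right, Filter.eventually_cofinite] using this
  filter_upwards [Filter.eventually_ge_atTop hfin.toFinset] with s hs
  rw [dist_eq_norm]
  refine lt_of_le_of_lt (ContinuousLinearMap.opNorm_le_bound _ (by positivity : 0 ≤ ε / 2) fun u =>
      ?_)
    (half_lt_self hε)
  refine norm_le_of_norm_coeff_le (by positivity) fun p => ?_
  have e : coeff ((F s - T) u : L2) p = (if p ∈ s then m p * coeff u p else 0)
      - m p * coeff u p := by
    rw [← hF, ← hT, ← coeffL_apply, ← coeffL_apply, ← coeffL_apply, ← map_sub]
    rfl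
  rw [e]
  split_ifs with hp
  · rw [sub_self, norm_zero]
    positivity
  · rw [zero_sub, norm_neg, norm_mul]
    refine mul_le_mul_of_nonneg_right ?_ (norm_nonneg _)
    by_contra hlt
    exact hp (hs (hfin.mem_toFinset.2 fun h => hlt h.le))

theorem tendsto_inv_sub_cofinite (k : ℂ) :
    Filter.Tendsto (fun p : dualModule => ((p : ℂ) - k)⁻¹) Filter.cofinite (nhds 0) := by
  rw [Metric.tendsto_nhds]
  intro ε hε
  rw [Filter.eventually_cofinite]
  refine (finite_norm_dualModule_le (ε⁻¹ + ‖k‖)).subset fun p hp => ?_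
  change ‖(p : ℂ)‖ ≤ _
  by_contra hlt
  apply hp
  rw [dist_zero_right, norm_inv]
  have := norm_sub_norm_le (p : ℂ) k
  exact inv_lt_of_inv_lt₀ hε (by linarith)

/-! ### Operators on `L²(ℂ / Γ; ℂ²)` -/

theorem L2C2_ext {u v : L2C2} (h1 : ∀ p, coeff u.fst p = coeff v.fst p)
    (h2 : ∀ p, coeff u.snd p = coeff v.snd p) : u = v :=
  WithLp.ofLp_injective 2 (Prod.ext (coeff_ext h1) (coeff_ext h2))

/-- The bounded operator `(u, v) ↦ (R u, R v)`. -/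
def diagCLM (R : L2 →L[ℂ] L2) : L2C2 →L[ℂ] L2C2 :=
  ((WithLp.prodContinuousLinearEquiv 2 ℂ L2 L2).symm : L2 × L2 →L[ℂ] L2C2).comp
    ((R.comp (WithLp.fstL 2 ℂ L2 L2)).prod (R.comp (WithLp.sndL 2 ℂ L2 L2)))

/-- The bounded operator `(u, v) ↦ (V v, W u)`. -/
def offDiagCLM (V W : L2 →L[ℂ] L2) : L2C2 →L[ℂ] L2C2 :=
  ((WithLp.prodContinuousLinearEquiv 2 ℂ L2 L2).symm : L2 × L2 →L[ℂ] L2C2).comp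
    ((V.comp (WithLp.sndL 2 ℂ L2 L2)).prod (W.comp (WithLp.fstL 2 ℂ L2 L2)))

theorem isCompactOperator_diagCLM {R : L2 →L[ℂ] L2} (hR : IsCompactOperator R) :
    IsCompactOperator (diagCLM R) := by
  have h1 : IsCompactOperator (ContinuousLinearMap.inl ℂ L2 L2 ∘ R ∘ WithLp.fstL 2 ℂ L2 L2) :=
    (hR.comp_clm _).clm_comp _
  have h2 : IsCompactOperator (ContinuousLinearMap.inr ℂ L2 L2 ∘ R ∘ WithLp.sndL 2 ℂ L2 L2) :=
    (hR.comp_clm _).clm_comp _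
  have h3 := (h1.add h2).clm_comp
    ((WithLp.prodContinuousLinearEquiv 2 ℂ L2 L2).symm : L2 × L2 →L[ℂ] L2C2)
  refine (congrArg IsCompactOperator (funext fun u => ?_)).mpr h3
  refine WithLp.ofLp_injective 2 (Prod.ext ?_ ?_)
  · exact (add_zero _).symm
  · exact (zero_add _).symm

theorem mem_twoDbar_domain_iff (u : L2C2) : u ∈ twoDbar.domain ↔
    Memℓp (fun p : dualModule => (p : ℂ) * coeff u.fst p) 2 ∧
      Memℓp (fun p : dualModule => (p : ℂ) * coeff u.snd p) 2 := by
  rw [← mem_two_smul_Dbar_domain_iff, ← mem_two_smul_Dbar_domain_iff]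
  exact ⟨fun h => ⟨h.1.1, h.2.2⟩, fun h => ⟨⟨h.1, trivial⟩, ⟨trivial, h.2⟩⟩⟩

theorem coeff_twoDbar_fst (u : twoDbar.domain) (p : dualModule) :
    coeff (twoDbar u).fst p = p * coeff u.1.fst p := by
  rw [← coeff_two_smul_Dbar ⟨u.1.fst, u.2.1.1⟩]
  congr 2
  exact add_zero _

theorem coeff_twoDbar_snd (u : twoDbar.domain) (p : dualModule) :
    coeff (twoDbar u).snd p = p * coeff u.1.snd p := by
  rw [← coeff_two_smul_Dbar ⟨u.1.snd, u.2.2.2⟩]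
  congr 2
  exact zero_add _

theorem coeff_sub (u v : L2) (p : dualModule) :
    coeff (u - v : L2) p = coeff u p - coeff v p := by
  rw [← coeffL_apply, ← coeffL_apply, ← coeffL_apply, map_sub]

theorem exists_isResolvent_twoDbar {k : ℂ} (hk : k ∉ dualLattice) :
    ∃ R : L2 →L[ℂ] L2, IsCompactOperator R ∧ IsResolvent twoDbar k (diagCLM R) := by
  obtain ⟨δ, hδ, h⟩ := exists_dist_dualModule_le hk
  obtain ⟨R, hR⟩ := exists_multiplier (m := fun p : dualModule => ((p : ℂ) - k)⁻¹) (C := δ⁻¹)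
    (fun p => by rw [norm_inv]; exact inv_anti₀ hδ (h p))
  have hm : ∀ f : L2, Memℓp (fun p : dualModule => (p : ℂ) * coeff (R f) p) 2 := by
    intro f
    -- Uses p / (p - k) = 1 + k / (p - k).
    have e : (fun p : dualModule => (p : ℂ) * coeff (R f) p) = coeff f + k • coeff (R f) := by
      funext p
      rw [Pi.add_apply, Pi.smul_apply, smul_eq_mul, hR]
      have := sub_ne_zero_of_not_mem hk p
      field_simp
      ring
    rw [e]
    exact (memℓp_coeff _).add ((memℓp_coeff _).const_smul _)
  refine ⟨R, isCompactOperator_of_multiplier (tendsto_inv_sub_cofinite k) hR,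
    fun f => (mem_twoDbar_domain_iff _).2 ⟨hm _, hm _⟩, fun f => ?_, fun u => ?_⟩
  · refine L2C2_ext (fun p => ?_) fun p => ?_
    · rw [WithLp.sub_fst, coeff_sub, coeff_twoDbar_fst, WithLp.smul_fst, coeff_smul]
      change p * coeff (R f.fst) p - k * coeff (R f.fst) p = _
      have := sub_ne_zero_of_not_mem hk p
      rw [hR]
      field_simp
    · rw [WithLp.sub_snd, coeff_sub, coeff_twoDbar_snd, WithLp.smul_snd, coeff_smul]
      change p * coeff (R f.snd) p - k * coeff (R f.snd) p = _
      have := sub_ne_zero_of_not_mem hk p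
      rw [hR]
      field_simp
  · refine L2C2_ext (fun p => ?_) fun p => ?_
    · change coeff (R (twoDbar u - k • (u : L2C2)).fst) p = _
      have := sub_ne_zero_of_not_mem hk p
      rw [hR, WithLp.sub_fst, coeff_sub, coeff_twoDbar_fst, WithLp.smul_fst, coeff_smul]
      field_simp
    · change coeff (R (twoDbar u - k • (u : L2C2)).snd) p = _
      have := sub_ne_zero_of_not_mem hk p
      rw [hR, WithLp.sub_snd, coeff_sub, coeff_twoDbar_snd, WithLp.smul_snd, coeff_smul]
      field_simp

theorem exists_mulCLM {f : Torus → ℂ} (hf : Continuous f) :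
    ∃ V : L2 →L[ℂ] L2, ∀ u : (mulOp f).domain, mulOp f u = V u := by
  have hdom := mulOp_domain hf
  obtain ⟨C, hC⟩ := isCompact_univ.exists_bound_of_continuousOn hf.continuousOn
  have hm : ∀ u : L2, u ∈ (mulOp f).domain := fun u => by rw [hdom]; trivial
  refine ⟨LinearMap.mkContinuous ((mulOp f).toFun.comp
    ((LinearMap.id : L2 →ₗ[ℂ] L2).codRestrict (mulOp f).domain hm)) C fun u => ?_, fun u => rfl⟩
  refine Lp.norm_le_mul_norm_of_ae_le_mul ?_
  filter_upwards [MemLp.coeFn_toLp (hm u)] with x hx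
  change ‖(MemLp.toLp (fun x => f x * u x) (hm u) : L2) x‖ ≤ _
  rw [hx, norm_mul]
  exact mul_le_mul_of_nonneg_right (hC x trivial) (norm_nonneg _)

theorem coeff_const_mul (c : ℂ) (f : Torus → ℂ) (p : dualModule) :
    coeff (fun x => c * f x) p = c * coeff f p := by
  have e : (fun x => char (-p) x * (c * f x)) = fun x => c * (char (-p) x * f x) := by
    funext x
    ring
  rw [coeff, coeff, e, integral_const_mul, mul_left_comm]

theorem conv_const_mul (c : ℂ) (a x : dualModule → ℂ) (p : dualModule) :
    conv (fun p => c * a p) x p = c * conv a x p := by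
  rw [conv, conv, ← tsum_mul_left]
  simp_rw [mul_assoc]

theorem mulOp_const_mul {f : Torus → ℂ} (hf : Continuous f) {V : L2 →L[ℂ] L2}
    (hV : ∀ u : (mulOp f).domain, mulOp f u = V u) (c : ℂ) (u : (mulOp fun x => c * f x).domain) :
    mulOp (fun x => c * f x) u = c • V u := by
  have hm : (u : L2) ∈ (mulOp f).domain := by rw [mulOp_domain hf]; trivial
  refine coeff_ext fun p => ?_
  rw [← hV ⟨u, hm⟩, coeff_smul, coeff_mulOp hf, coeff_mulOp (f := fun x => c * f x)
      (continuous_const.mul hf), ← conv_const_mul]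
  congr 1
  funext p
  exact coeff_const_mul c f p

theorem IsResolvent.inverse_domain {E : Type*} [NormedAddCommGroup E] [NormedSpace ℂ E]
    {A : E →ₗ.[ℂ] E} {z : ℂ} {R : E →L[ℂ] E} (h : IsResolvent A z R) :
    (A - scalarOp E z).inverse.domain = ⊤ := by
  rw [eq_top_iff]
  intro f _
  have hf : f ∈ LinearMap.range (A - scalarOp E z).toFun :=
    ⟨⟨R f, h.mem f, trivial⟩, h.apply f⟩
  rwa [LinearPMap.inverse_domain]

theorem IsResolvent.inverse_apply {E : Type*} [NormedAddCommGroup E] [NormedSpace ℂ E]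
    {A : E →ₗ.[ℂ] E} {z : ℂ} {R : E →L[ℂ] E} (h : IsResolvent A z R)
    (f : (A - scalarOp E z).inverse.domain) : (A - scalarOp E z).inverse f = R f := by
  have hker : LinearMap.ker (A - scalarOp E z).toFun = ⊥ := by
    rw [LinearMap.ker_eq_bot']
    intro u hu
    have e : A ⟨u, u.2.1⟩ - z • (u : E) = 0 := hu
    have e2 := h.apply_sub ⟨u, u.2.1⟩
    rw [e, map_zero] at e2
    exact Subtype.ext e2.symm
  exact LinearPMap.inverse_apply_eq hker (x := ⟨R f, h.mem f, trivial⟩) (h.apply f)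

/-! ### The operators `D(α)` and `T_k` -/

section Operators

variable {U : Torus → ℂ} {V W : L2 →L[ℂ] L2}

theorem T_domain (hU : Continuous U) {k : ℂ} {R : L2C2 →L[ℂ] L2C2} (hR : IsResolvent twoDbar k R) :
    (T U k).domain = ⊤ := by
  rw [eq_top_iff]
  intro u _
  have hU' : Continuous fun x => U (-x) := hU.comp continuous_neg
  refine ⟨⟨⟨trivial, ?_⟩, ?_, trivial⟩, ?_⟩
  · rw [mulOp_domain hU']; trivial
  · rw [mulOp_domain hU]; trivial
  · rw [hR.inverse_domain]; trivial

theorem T_apply (hV : ∀ u : (mulOp U).domain, mulOp U u = V u)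
    (hW : ∀ u : (mulOp fun x => U (-x)).domain, mulOp (fun x => U (-x)) u = W u) {k : ℂ}
    {R : L2C2 →L[ℂ] L2C2} (hR : IsResolvent twoDbar k R) (u : (T U k).domain) :
    T U k u = (R * offDiagCLM V W) u := by
  refine (hR.inverse_apply _).trans (congrArg R (WithLp.ofLp_injective 2 (Prod.ext ?_ ?_)))
  · exact (zero_add _).trans (hV _)
  · exact (add_zero _).trans (hW _)

theorem D_domain (hU : Continuous U) (α : ℂ) : (D U α).domain = twoDbar.domain := by
  have h1 := mulOp_domain (f := fun x => α * U x) (continuous_const.mul hU)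
  have h2 := mulOp_domain (f := fun x => α * U (-x))
    (continuous_const.mul (hU.comp continuous_neg))
  ext u
  refine ⟨fun h => ⟨⟨h.1.1, trivial⟩, trivial, h.2.2⟩, fun h => ⟨⟨h.1.1, ?_⟩, ?_, h.2.2⟩⟩
  · rw [h2]; trivial
  · rw [h1]; trivial

theorem D_apply (hU : Continuous U) (hV : ∀ u : (mulOp U).domain, mulOp U u = V u)
    (hW : ∀ u : (mulOp fun x => U (-x)).domain, mulOp (fun x => U (-x)) u = W u) (α : ℂ)
    (u : L2C2) (h : u ∈ (D U α).domain) (h' : u ∈ twoDbar.domain) :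
    D U α ⟨u, h⟩ = twoDbar ⟨u, h'⟩ + (α • offDiagCLM V W) u := by
  refine WithLp.ofLp_injective 2 (Prod.ext ?_ ?_)
  · refine (congrArg (_ + ·) (mulOp_const_mul hU hV α _)).trans ?_
    exact congrArg (· + α • V u.snd) (add_zero (((2 : ℂ) • Dbar) ⟨u.fst, h.1.1⟩)).symm
  · refine (congrArg (· + _) (mulOp_const_mul (hU.comp continuous_neg) hW α _)).trans ?_
    refine (add_comm _ _).trans ?_
    exact congrArg (· + α • W u.fst) (zero_add (((2 : ℂ) • Dbar) ⟨u.snd, h.2.2⟩)).symm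

theorem coeff_D_fst (hU : Continuous U) {α : ℂ} (u : (D U α).domain) (p : dualModule) :
    coeff (D U α u).fst p =
      p * coeff u.1.fst p + conv (coeff fun x => α * U x) (coeff u.1.snd) p := by
  rw [← coeff_two_smul_Dbar ⟨u.1.fst, u.2.1.1⟩,
    ← coeff_mulOp (f := fun x => α * U x) (continuous_const.mul hU) ⟨u.1.snd, u.2.2.1⟩, ← coeff_add]
  rfl

theorem coeff_D_snd (hU : Continuous U) {α : ℂ} (u : (D U α).domain) (p : dualModule) :
    coeff (D U α u).snd p =
      p * coeff u.1.snd p + conv (coeff fun x => α * U (-x)) (coeff u.1.fst) p := by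
  rw [← coeff_two_smul_Dbar ⟨u.1.snd, u.2.2.2⟩,
    ← coeff_mulOp (f := fun x => α * U (-x)) (continuous_const.mul (hU.comp continuous_neg))
      ⟨u.1.fst, u.2.1.2⟩,
    add_comm, ← coeff_add]
  rfl

theorem dense_two_smul_Dbar_domain : Dense (((2 : ℂ) • Dbar).domain : Set L2) := by
  have h : Submodule.span ℂ (Set.range charBasis) ≤ ((2 : ℂ) • Dbar).domain := by
    rw [Submodule.span_le]
    rintro _ ⟨q, rfl⟩
    rw [SetLike.mem_coe, charBasis_apply]
    refine Submodule.smul_mem _ _ ((mem_two_smul_Dbar_domain_iff _).2 ?_)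
    refine memℓp_of_norm_le ((memℓp_coeff (charLp q)).const_smul (q : ℂ)) fun p => ?_
    rw [Pi.smul_apply, smul_eq_mul, coeff_charLp]
    split_ifs with hpq
    · rw [hpq]
    · simp
  exact ((Submodule.dense_iff_topologicalClosure_eq_top).2 charBasis.dense_span).mono h

theorem dense_D_domain (hU : Continuous U) (α : ℂ) : Dense ((D U α).domain : Set L2C2) := by
  rw [D_domain hU]
  have h := (dense_two_smul_Dbar_domain.prod dense_two_smul_Dbar_domain).preimage
    (WithLp.prodContinuousLinearEquiv 2 ℂ L2 L2).toHomeomorph.isOpenMap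
  exact h.mono fun u hu => ⟨⟨hu.1, trivial⟩, trivial, hu.2⟩

/-! ### The spectrum of `D(α)` -/

/-- The Fredholm alternative produces an L² eigenfunction, and the bootstrap makes its coefficients
decay. -/
theorem exists_isEigenSeq_of_mem_Spec (hU : IsSmooth U) {α k : ℂ} (hk : k ∉ dualLattice)
    (h : k ∈ Spec (D U α)) : ∃ x y, IsEigenSeq (coeff fun x => α * U x)
      (coeff fun x => α * U (-x)) k x y ∧ RapidDecay x ∧ RapidDecay y ∧ ∃ p, x p ≠ 0 ∨ y p ≠ 0 := by
  have hc := hU.continuous'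
  obtain ⟨V, hV⟩ := exists_mulCLM hc
  obtain ⟨W, hW⟩ := exists_mulCLM (f := fun x => U (-x)) (hc.comp continuous_neg)
  obtain ⟨R, hRc, hR⟩ := exists_isResolvent_twoDbar hk
  obtain ⟨u, hu0, hu⟩ := (hR.mem_Spec_add_iff (D_domain hc α) (D_apply hc hV hW α)
    ((isCompactOperator_diagCLM hRc).comp_clm _)).1 h
  have e : diagCLM R (-(α • offDiagCLM V W) u) = u := by rw [map_neg, hu, neg_neg]
  have hm' : u ∈ twoDbar.domain := by
    rw [← e]
    exact hR.mem _
  have hm : u ∈ (D U α).domain := by rwa [D_domain hc]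
  have heig : D U α ⟨u, hm⟩ = k • u := by
    have e2 := hR.apply (-(α • offDiagCLM V W) u)
    simp only [e] at e2
    rw [sub_eq_iff_eq_add] at e2
    rw [D_apply hc hV hW α u hm hm', e2]
    abel
  have hs : IsEigenSeq (coeff fun x => α * U x) (coeff fun x => α * U (-x)) k
      (coeff u.fst) (coeff u.snd) := by
    refine ⟨fun p => ?_, fun p => ?_⟩
    · have e3 := coeff_D_fst hc ⟨u, hm⟩ p
      rw [heig, WithLp.smul_fst, coeff_smul] at e3
      linear_combination -e3
    · have e3 := coeff_D_snd hc ⟨u, hm⟩ p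
      rw [heig, WithLp.smul_snd, coeff_smul] at e3
      linear_combination -e3
  obtain ⟨hx, hy⟩ := hs.rapidDecay (hU.const_mul α).rapidDecay (hU.neg_arg.const_mul α).rapidDecay
      hk
    (C := max ((√vol)⁻¹ * ‖u.fst‖) ((√vol)⁻¹ * ‖u.snd‖))
    (fun p => (norm_coeff_le _ p).trans (le_max_left _ _))
    (fun p => (norm_coeff_le _ p).trans (le_max_right _ _))
  refine ⟨_, _, hs, hx, hy, ?_⟩
  by_contra! hne
  exact hu0 (L2C2_ext (fun p => (hne p).1.trans (coeff_zero p).symm)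
    fun p => (hne p).2.trans (coeff_zero p).symm)

theorem IsEigenSeq.mem_Spec (hU : IsSmooth U) {α k : ℂ} {x y : dualModule → ℂ}
    (h : IsEigenSeq (coeff fun x => α * U x) (coeff fun x => α * U (-x)) k x y)
    (hx : RapidDecay x) (hy : RapidDecay y) {p : dualModule} (hp : x p ≠ 0 ∨ y p ≠ 0) :
    k ∈ Spec (D U α) := by
  have hc := hU.continuous'
  obtain ⟨u, hu⟩ := exists_coeff_eq hx.memℓp
  obtain ⟨v, hv⟩ := exists_coeff_eq hy.memℓp
  have hu' : coeff u = x := funext hu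
  have hv' : coeff v = y := funext hv
  have hm : WithLp.toLp 2 (u, v) ∈ (D U α).domain := by
    rw [D_domain hc, mem_twoDbar_domain_iff]
    change Memℓp (fun p : dualModule => (p : ℂ) * coeff u p) 2 ∧
      Memℓp (fun p : dualModule => (p : ℂ) * coeff v p) 2
    rw [hu', hv']
    exact ⟨hx.mul_coe.memℓp, hy.mul_coe.memℓp⟩
  refine mem_Spec_of_eigenvector ⟨_, hm⟩ (fun h0 => ?_) (L2C2_ext (fun q => ?_) fun q => ?_)
  · have h1 : u = 0 := congrArg WithLp.fst h0
    have h2 : v = 0 := congrArg WithLp.snd h0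
    rw [← hu, ← hv, h1, h2, coeff_zero] at hp
    simp at hp
  · rw [coeff_D_fst hc, WithLp.smul_fst, coeff_smul]
    change q * coeff u q + conv _ (coeff v) q = k * coeff u q
    rw [hu', hv']
    linear_combination h.left q
  · rw [coeff_D_snd hc, WithLp.smul_snd, coeff_smul]
    change q * coeff v q + conv _ (coeff u) q = k * coeff v q
    rw [hu', hv']
    linear_combination h.right q

theorem isClosed_Spec_D (U : Torus → ℂ) (α : ℂ) : IsClosed (Spec (D U α)) :=
  (isOpen_resolventSet _).isClosed_compl

/-- The eigenfunction at k has a common zero; multiplying by the Green function with its pole there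
moves the eigenvalue by k'. -/
theorem exists_ball_subset_Spec_D (hU : IsPotential U) {α k : ℂ} (hk : k ∉ dualLattice)
    (h : k ∈ Spec (D U α)) : ∃ ε > 0, ∀ k', ‖k'‖ < ε → k + k' ∉ dualLattice →
      k + k' ∈ Spec (D U α) := by
  obtain ⟨x, y, hs, hx, hy, p, hp⟩ := exists_isEigenSeq_of_mem_Spec hU.smooth hk h
  have hF := hU.smooth.const_mul α
  have hG := hU.smooth.neg_arg.const_mul α
  obtain ⟨z, hzx, hzy⟩ := hs.exists_zero hk hF.rapidDecay hG.rapidDecay hx hy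
    (fun z => by
      rw [series, series, (hF.hasSum_coeff _).tsum_eq, (hF.hasSum_coeff _).tsum_eq, hU.rotation]
      ring)
    (fun z => by
      rw [series, series, (hG.hasSum_coeff _).tsum_eq, (hG.hasSum_coeff _).tsum_eq,
        ← QuotientAddGroup.mk_neg, ← QuotientAddGroup.mk_neg, ← mul_neg, hU.rotation]
      ring)
  have hne : ∃ ε > 0, ∀ k' : ℂ, k' ≠ 0 → ‖k'‖ < ε → k' ∉ dualLattice ∧
      (conv (greenCoeff k' z) x p ≠ 0 ∨ conv (greenCoeff k' z) y p ≠ 0) := by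
    rcases hp with hp | hp
    · obtain ⟨ε, hε, h⟩ := exists_conv_greenCoeff_ne_zero hx.summable hp z
      exact ⟨ε, hε, fun k' h1 h2 => ⟨(h k' h1 h2).1, .inl (h k' h1 h2).2⟩⟩
    · obtain ⟨ε, hε, h⟩ := exists_conv_greenCoeff_ne_zero hy.summable hp z
      exact ⟨ε, hε, fun k' h1 h2 => ⟨(h k' h1 h2).1, .inr (h k' h1 h2).2⟩⟩
  obtain ⟨ε, hε, hne⟩ := hne
  refine ⟨ε, hε, fun k' hlt hkk => ?_⟩
  by_cases h0 : k' = 0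
  · rwa [h0, add_zero]
  obtain ⟨hk', hn⟩ := hne k' h0 hlt
  obtain ⟨C, hC⟩ := exists_norm_greenCoeff_le hk' z
  have hs' : IsEigenSeq (coeff fun x => α * U x) (coeff fun x => α * U (-x)) (k + k')
      (conv (greenCoeff k' z) x) (conv (greenCoeff k' z) y) :=
    ⟨green_eq hk' hF.rapidDecay.summable hx.summable hy.summable hs.left hzx,
      green_eq hk' hG.rapidDecay.summable hy.summable hx.summable hs.right hzy⟩
  -- The new sequences are only known to be bounded, so the bootstrap is run again; this needs k +
  -- k' ∉ Γ*.
  obtain ⟨hx', hy'⟩ := hs'.rapidDecay hF.rapidDecay hG.rapidDecay hkk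
    (C := max (C * ∑' q, ‖x q‖) (C * ∑' q, ‖y q‖))
    (fun p => (norm_conv_le hx.summable hC p).trans (le_max_left _ _))
    (fun p => (norm_conv_le hy.summable hC p).trans (le_max_right _ _))
  exact hs'.mem_Spec hU.smooth hx' hy' hn

/-- The spectrum is open and closed relative to the complement of the countable set Γ*, which is
connected and dense; closedness then adds Γ* itself. -/
theorem Spec_D_eq_univ (hU : IsPotential U) {α k : ℂ} (hk : k ∉ dualLattice)
    (h : k ∈ Spec (D U α)) : Spec (D U α) = Set.univ := by
  have hS := isClosed_Spec_D U α
  have hopen : IsOpen (Spec (D U α) ∩ dualLatticeᶜ) := by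
    rw [Metric.isOpen_iff]
    rintro q ⟨hq, hqd⟩
    obtain ⟨ε, hε, hball⟩ := exists_ball_subset_Spec_D hU hqd hq
    obtain ⟨δ, hδ, hsub⟩ := Metric.isOpen_iff.1 isClosed_dualLattice.isOpen_compl q hqd
    refine ⟨min ε δ, lt_min hε hδ, fun w hw => ?_⟩
    have hwd : w ∈ dualLatticeᶜ := hsub (Metric.ball_subset_ball (min_le_right _ _) hw)
    have hwε : ‖w - q‖ < ε := mem_ball_iff_norm.1 (Metric.ball_subset_ball (min_le_left _ _) hw)
    refine ⟨?_, hwd⟩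
    have := hball (w - q) hwε
    rw [add_sub_cancel] at this
    exact this hwd
  have hconn : IsPreconnected (dualLatticeᶜ) :=
    (countable_dualLattice.isConnected_compl_of_one_lt_rank
      (by rw [Complex.rank_real_complex]; exact Nat.one_lt_ofNat)).isPreconnected
  have hsub := hconn.subset_of_closure_inter_subset hopen ⟨k, hk, h, hk⟩
    fun w hw => ⟨hS.closure_subset (closure_mono Set.inter_subset_left hw.1), hw.2⟩
  rw [← Set.univ_subset_iff, ← (countable_dualLattice.dense_compl ℝ).closure_eq]
  exact hS.closure_subset_iff.2 fun w hw => (hsub hw).1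

/-! ### The spectrum of `T_k` -/

theorem Spec_T_eq (hU : Continuous U) (hV : ∀ u : (mulOp U).domain, mulOp U u = V u)
    (hW : ∀ u : (mulOp fun x => U (-x)).domain, mulOp (fun x => U (-x)) u = W u) {k : ℂ}
    {R : L2C2 →L[ℂ] L2C2} (hR : IsResolvent twoDbar k R) :
    Spec (T U k) = spectrum ℂ (R * offDiagCLM V W) :=
  Spec_eq_spectrum (T_domain hU hR) (T_apply hV hW hR)

theorem mem_Spec_D_iff (hU : Continuous U) {k : ℂ} (hk : k ∉ dualLattice) (α : ℂ) :
    k ∈ Spec (D U α) ↔ α ≠ 0 ∧ 1 / α ∈ Spec (T U k) := by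
  obtain ⟨V, hV⟩ := exists_mulCLM hU
  obtain ⟨W, hW⟩ := exists_mulCLM (f := fun x => U (-x)) (hU.comp continuous_neg)
  obtain ⟨R, hRc, hR⟩ := exists_isResolvent_twoDbar hk
  have hcomp : IsCompactOperator (diagCLM R * offDiagCLM V W) :=
    (isCompactOperator_diagCLM hRc).comp_clm _
  rw [hR.mem_Spec_add_iff (D_domain hU α) (D_apply hU hV hW α)
    ((isCompactOperator_diagCLM hRc).comp_clm _), Spec_T_eq hU hV hW hR]
  by_cases hα : α = 0
  · refine iff_of_false (fun ⟨u, hu, h⟩ => hu ?_) fun h => h.1 hα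
    have e : (α • offDiagCLM V W) u = 0 := by
      rw [hα]
      exact zero_smul ℂ (offDiagCLM V W u)
    rw [e, map_zero] at h
    exact neg_eq_zero.1 h.symm
  rw [← hcomp.hasEigenvalue_iff_mem_spectrum (one_div_ne_zero hα)]
  -- Fredholm theory gives the eigenvalue -1/α, the statement wants 1/α: diag(1, -1) anticommutes
  -- with the off-diagonal potential and commutes with the resolvent.
  have flip : ∀ (c d : ℂ) (u : L2C2), c • diagCLM R (offDiagCLM V W u) = d • u →
      c • diagCLM R (offDiagCLM V W (WithLp.toLp 2 (u.fst, -u.snd))) =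
        -(d • WithLp.toLp 2 (u.fst, -u.snd)) := by
    intro c d u h
    have h1 : c • R (V u.snd) = d • u.fst := congrArg WithLp.fst h
    have h2 : c • R (W u.fst) = d • u.snd := congrArg WithLp.snd h
    refine WithLp.ofLp_injective 2 (Prod.ext ?_ ?_)
    · change c • R (V (-u.snd)) = -(d • u.fst)
      rw [map_neg, map_neg, smul_neg, h1]
    · change c • R (W u.fst) = -(d • -u.snd)
      rw [smul_neg, neg_neg, h2]
  have flip_ne : ∀ u : L2C2, u ≠ 0 → (WithLp.toLp 2 (u.fst, -u.snd) : L2C2) ≠ 0 := by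
    intro u hu h
    refine hu (WithLp.ofLp_injective 2 (Prod.ext ?_ ?_))
    · have := congrArg (fun w : L2C2 => w.fst) h
      exact this
    · exact neg_eq_zero.1 (congrArg (fun w : L2C2 => w.snd) h)
  constructor
  · rintro ⟨u, hu, h⟩
    refine ⟨hα, Module.End.hasEigenvalue_of_hasEigenvector
      (x := WithLp.toLp 2 (u.fst, -u.snd)) ⟨?_, flip_ne u hu⟩⟩
    rw [Module.End.mem_eigenspace_iff]
    have h' : α • diagCLM R (offDiagCLM V W u) = (-1 : ℂ) • u := by
      rw [neg_one_smul, ← h, ← map_smul]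
      rfl
    have := flip _ _ _ h'
    rw [neg_one_smul, neg_neg] at this
    rw [one_div, eq_inv_smul_iff₀ hα]
    exact this
  · rintro ⟨-, h⟩
    obtain ⟨u, hu, hu0⟩ := h.exists_hasEigenvector
    rw [Module.End.mem_eigenspace_iff, one_div, eq_inv_smul_iff₀ hα] at hu
    refine ⟨_, flip_ne u hu0, ?_⟩
    have := flip α 1 u (by rw [one_smul]; exact hu)
    rw [one_smul] at this
    rw [← this, ← map_smul]
    rfl

theorem mem_Spec_D_iff_Spec_eq_univ (hU : IsPotential U) {k : ℂ} (hk : k ∉ dualLattice) (α : ℂ) :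
    k ∈ Spec (D U α) ↔ Spec (D U α) = Set.univ :=
  ⟨Spec_D_eq_univ hU hk, fun h => h ▸ trivial⟩

/-- The point 0 is not of the form 1/α and is treated apart: T_k and T_k' differ by an invertible
left factor. -/
theorem zero_mem_Spec_T_of_mem (hU : Continuous U) {k k' : ℂ} (hk : k ∉ dualLattice)
    (hk' : k' ∉ dualLattice) (h : 0 ∈ Spec (T U k)) : 0 ∈ Spec (T U k') := by
  obtain ⟨V, hV⟩ := exists_mulCLM hU
  obtain ⟨W, hW⟩ := exists_mulCLM (f := fun x => U (-x)) (hU.comp continuous_neg)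
  obtain ⟨R, -, hR⟩ := exists_isResolvent_twoDbar hk
  obtain ⟨R', -, hR'⟩ := exists_isResolvent_twoDbar hk'
  obtain ⟨Q, hQ⟩ := hR.exists_unit_mul hR'
  rw [Spec_T_eq hU hV hW hR, spectrum.zero_mem_iff] at h
  rwa [Spec_T_eq hU hV hW hR', spectrum.zero_mem_iff, hQ, mul_assoc, Units.isUnit_units_mul]

/-- For z ≠ 0 membership amounts to Spec D(1/z) = ℂ, a condition that does not involve k. -/
theorem Spec_T_subset (hU : IsPotential U) {k k' : ℂ} (hk : k ∉ dualLattice)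
    (hk' : k' ∉ dualLattice) : Spec (T U k) ⊆ Spec (T U k') := by
  have hc := hU.smooth.continuous'
  intro z hz
  by_cases h0 : z = 0
  · subst h0
    exact zero_mem_Spec_T_of_mem hc hk hk' hz
  have h1 : k ∈ Spec (D U (1 / z)) :=
    (mem_Spec_D_iff hc hk _).2 ⟨one_div_ne_zero h0, by rwa [one_div_one_div]⟩
  rw [mem_Spec_D_iff_Spec_eq_univ hU hk, ← mem_Spec_D_iff_Spec_eq_univ hU hk',
    mem_Spec_D_iff hc hk', one_div_one_div] at h1
  exact h1.2

theorem isCompactOperator_T (hU : Continuous U) {k : ℂ} (hk : k ∉ dualLattice) :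
    IsCompactOperator fun u : (T U k).domain => T U k u := by
  obtain ⟨V, hV⟩ := exists_mulCLM hU
  obtain ⟨W, hW⟩ := exists_mulCLM (f := fun x => U (-x)) (hU.comp continuous_neg)
  obtain ⟨R, hRc, hR⟩ := exists_isResolvent_twoDbar hk
  have e : (fun u : (T U k).domain => T U k u) =
      diagCLM R ∘ (offDiagCLM V W).comp (T U k).domain.subtypeL :=
    funext (T_apply hV hW hR)
  rw [e]
  exact (isCompactOperator_diagCLM hRc).comp_clm _

theorem zero_mem_Spec_H_iff (hU : Continuous U) (α p : ℂ) :
    0 ∈ Spec (H U p α) ↔ p ∈ Spec (D U α) :=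
  not_congr (zero_mem_resolventSet_block_iff (dense_D_domain hU α) p)

end Operators

end TBG

end

theorem theorem2 (U : TBG.Torus → ℂ) (hU : TBG.IsPotential U) :
    (∀ k : ℂ, k ∉ TBG.dualLattice →
      k ∈ TBG.resolventSet TBG.twoDbar ∧
      (TBG.T U k).domain = ⊤ ∧
      IsCompactOperator (fun u : (TBG.T U k).domain => TBG.T U k u)) ∧
    (∀ k k' : ℂ, k ∉ TBG.dualLattice → k' ∉ TBG.dualLattice →
      TBG.Spec (TBG.T U k) = TBG.Spec (TBG.T U k')) ∧
    (∀ k : ℂ, k ∉ TBG.dualLattice → ∀ α : ℂ,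
      List.TFAE [
        α ≠ 0 ∧ 1 / α ∈ TBG.Spec (TBG.T U k),
        TBG.Spec (TBG.D U α) = Set.univ,
        0 ∈ ⋂ p : ℂ, TBG.Spec (TBG.H U p α)]) := by
  have hc := hU.smooth.continuous'
  refine ⟨fun k hk => ?_, fun k k' hk hk' =>
    (TBG.Spec_T_subset hU hk hk').antisymm (TBG.Spec_T_subset hU hk' hk), fun k hk α => ?_⟩
  · obtain ⟨R, -, hR⟩ := TBG.exists_isResolvent_twoDbar hk
    exact ⟨TBG.mem_resolventSet_iff.2 ⟨_, hR⟩, TBG.T_domain hc hR, TBG.isCompactOperator_T hc hk⟩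
  · tfae_have 1 ↔ 2 := by
      rw [← TBG.mem_Spec_D_iff hc hk, TBG.mem_Spec_D_iff_Spec_eq_univ hU hk]
    tfae_have 2 ↔ 3 := by
      simp only [Set.mem_iInter, TBG.zero_mem_Spec_H_iff hc, Set.eq_univ_iff_forall]
    tfae_finish
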